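/- For every $\varepsilon>0$ there exists a constant $c=c(\varepsilon)>0$, depending only on $\varepsilon$, such that for all real numbers $H>0$ and $D>0$ the number $N(H,D)$ of polynomials $P(x)=c_3x^3+c_2x^2+c_1x+c_0$ with $c_0,c_1,c_2,c_3\in\mathbb{Z}$, $c_3\neq 0$, whose naive height $H(P)=\max\{|c_0|,|c_1|,|c_2|,|c_3|\}$ satisfies $H(P)\le H$ and whose discriminant $D(P)$ satisfies $0<|D(P)|\le D$, is finite and is bounded by $$N(H,D)\le c\,H^{2/3+\varepsilon}D^{5/6}.$$ -/

import Mathlib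

/-- The set of integer polynomials `P` of degree exactly three whose naive height
(the largest absolute value of a coefficient) is at most `H` and whose discriminant
satisfies `0 < |disc P| ≤ D`. -/
def boundedCubics (H D : ℝ) : Set (Polynomial ℤ) :=
  {P | P.natDegree = 3 ∧ P.supNorm ≤ H ∧ 0 < |P.discr| ∧ ((|P.discr| : ℤ) : ℝ) ≤ D}

/-! Identify a cubic polynomial with an integral binary cubic form and split the count by dyadic
ranges X ≤ |disc| ≤ 2X. Over ℝ such a form is μ(x³ + σxy²) with σ = ±1 in unimodular coordinates x,
y, and 4μ⁴ = |disc|, so |μ| is of order X^(1/4).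

Classes: reducing the lattice of the coordinates (x, y) gives every SL₂(ℤ)-class a representative in
one of boundedly many coefficient boxes or in a cusp with leading coefficient 0. This yields O(X log
H) representatives (`cardLE_reducedForms`, `exists_reducedForm`).

Orbits: if a substitution takes a representative to a form of height at most H, then the cubic form
and its Hessian are small at each column. Each column is thus a primitive vector close to a real
root line of x³ + σxy². With t³ of order H/|μ| there are O(t² log H) such vectors, and the longer
column determines the other up to five choices (`cardLE_orbit`).

The product is X·t², of order X·(H/X^(1/4))^(2/3) = H^(2/3) X^(5/6), up to logarithms
(`Cubic.cardLE_dyadic_discr`). Summing over ranges with X ≤ D gives H^(2/3) D^(5/6) log³ H, and H^ε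
absorbs the logarithms. -/

/-- `S` is finite with at most `B` elements. -/
def CardLE {α : Type*} (S : Set α) (B : ℝ) : Prop := S.Finite ∧ (S.ncard : ℝ) ≤ B

/-! ### Calculus of cardinality bounds. -/

namespace CardLE

variable {α β ι : Type*}

lemma mono {S T : Set α} {A B : ℝ} (h : CardLE T A) (hST : S ⊆ T) (hAB : A ≤ B) : CardLE S B :=
  ⟨h.1.subset hST, le_trans (by exact_mod_cast Set.ncard_le_ncard hST h.1) (h.2.trans hAB)⟩

lemma of_finset (s : Finset α) : CardLE (s : Set α) s.card :=
  ⟨s.finite_toSet, by simp⟩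

lemma image {S : Set α} {B : ℝ} (h : CardLE S B) (f : α → β) : CardLE (f '' S) B :=
  ⟨h.1.image f, le_trans (by exact_mod_cast Set.ncard_image_le h.1) h.2⟩

lemma of_injOn {S : Set α} {T : Set β} {B : ℝ} (h : CardLE T B) (f : α → β)
    (hf : Set.InjOn f S) (hm : Set.MapsTo f S T) : CardLE S B := by
  have h' := h.mono hm.image_subset le_rfl
  exact ⟨h'.1.of_finite_image hf, by rw [← hf.ncard_image]; exact h'.2⟩

lemma union {S T : Set α} {A B : ℝ} (hS : CardLE S A) (hT : CardLE T B) :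
    CardLE (S ∪ T) (A + B) :=
  ⟨hS.1.union hT.1, le_trans (by exact_mod_cast Set.ncard_union_le S T) (add_le_add hS.2 hT.2)⟩

lemma biUnion_sum (s : Finset ι) (S : ι → Set α) (B : ι → ℝ) (h : ∀ i ∈ s, CardLE (S i) (B i)) :
    CardLE (⋃ i ∈ s, S i) (∑ i ∈ s, B i) := by
  classical
  induction s using Finset.induction_on with
  | empty => simp [CardLE]
  | insert a s ha ih =>
    rw [Finset.set_biUnion_insert, Finset.sum_insert ha]
    exact (h a (by simp)).union (ih fun i hi => h i (by simp [hi]))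

lemma biUnion (s : Finset ι) (S : ι → Set α) (B : ℝ) (h : ∀ i ∈ s, CardLE (S i) B) :
    CardLE (⋃ i ∈ s, S i) (s.card * B) := by
  simpa using biUnion_sum s S (fun _ => B) h

lemma nonneg {S : Set α} {B : ℝ} (h : CardLE S B) : 0 ≤ B :=
  le_trans (by positivity) h.2

lemma biUnion_set {T : Set ι} {A B : ℝ} (hT : CardLE T A) (S : ι → Set α) (hB : 0 ≤ B)
    (h : ∀ i ∈ T, CardLE (S i) B) : CardLE (⋃ i ∈ T, S i) (A * B) := by
  have := biUnion hT.1.toFinset S B (fun i hi => h i (by simpa using hi))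
  refine this.mono (by simp) ?_
  rw [← Set.ncard_eq_toFinset_card T hT.1]
  exact mul_le_mul_of_nonneg_right hT.2 hB

lemma prod {S : Set α} {T : Set β} {A B : ℝ} (hS : CardLE S A) (hT : CardLE T B) :
    CardLE (S ×ˢ T) (A * B) := by
  refine ⟨hS.1.prod hT.1, ?_⟩
  rw [Set.ncard_prod]
  push_cast
  exact mul_le_mul hS.2 hT.2 (by positivity) hS.nonneg

lemma int_abs_le (B : ℝ) (hB : 0 ≤ B) : CardLE {n : ℤ | |(n : ℝ)| ≤ B} (2 * B + 1) := by
  refine (of_finset (Finset.Icc (-⌊B⌋) ⌊B⌋)).mono ?_ ?_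
  · intro n hn
    have h1 := abs_le.1 (show |(n : ℝ)| ≤ B from hn)
    simp only [Finset.coe_Icc, Set.mem_Icc]
    refine ⟨?_, Int.le_floor.2 h1.2⟩
    have : -n ≤ ⌊B⌋ := Int.le_floor.2 (by push_cast; linarith [h1.1])
    omega
  · have h0 : 0 ≤ ⌊B⌋ := Int.floor_nonneg.2 hB
    have : ((Finset.Icc (-⌊B⌋) ⌊B⌋).card : ℤ) = 2 * ⌊B⌋ + 1 := by
      rw [Int.card_Icc, Int.toNat_of_nonneg (by omega)]; ring
    have h2 : ((Finset.Icc (-⌊B⌋) ⌊B⌋).card : ℝ) = 2 * ⌊B⌋ + 1 := by exact_mod_cast this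
    rw [h2]
    linarith [Int.floor_le B]

/-- Elements of `S` that all lie at integer positions, at pairwise distance at most `m`,
on a parametrised line. -/
lemma of_line {S : Set α} (φ : α → ℤ → α) {m : ℝ} (hm : 0 ≤ m)
    (h : ∀ v ∈ S, ∀ w ∈ S, ∃ k : ℤ, w = φ v k ∧ |(k : ℝ)| ≤ m) : CardLE S (2 * m + 1) := by
  rcases S.eq_empty_or_nonempty with rfl | ⟨v, hv⟩
  · exact ⟨Set.finite_empty, by simp; positivity⟩
  · refine ((int_abs_le m hm).image (φ v)).mono ?_ le_rfl
    intro w hw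
    obtain ⟨k, hk, hk'⟩ := h v hv w hw
    exact ⟨k, hk', hk.symm⟩

end CardLE

/-! ### Primitive lattice points in parallelograms. -/

/-- Two integer vectors with the same determinant against a primitive vector `v` differ by a
multiple of `v`. -/
lemma exists_add_mul_of_det_eq {v w w' : ℤ × ℤ} (hv : IsCoprime v.1 v.2)
    (h : v.1 * w.2 - v.2 * w.1 = v.1 * w'.2 - v.2 * w'.1) :
    ∃ k : ℤ, w' = (w.1 + k * v.1, w.2 + k * v.2) := by
  obtain ⟨a, b, hab⟩ := hv
  refine ⟨a * (w'.1 - w.1) + b * (w'.2 - w.2), Prod.ext ?_ ?_⟩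
  · linear_combination (-(w'.1 - w.1)) * hab + b * h
  · linear_combination (-(w'.2 - w.2)) * hab - a * h

/-- Primitive integer points in a parallelogram of area `4 α β`. -/
lemma cardLE_primitive_parallelogram {a b c d α β : ℝ} (hdet : a * d - b * c = 1)
    (hα : 0 < α) (hβ : 0 < β) :
    CardLE {w : ℤ × ℤ | IsCoprime w.1 w.2 ∧ |a * w.1 + b * w.2| ≤ α ∧ |c * w.1 + d * w.2| ≤ β}
      (2 + 20 * (α * β)) := by
  set A := {w : ℤ × ℤ | IsCoprime w.1 w.2 ∧ |a * w.1 + b * w.2| ≤ α ∧ |c * w.1 + d * w.2| ≤ β}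
    with hA
  rcases A.eq_empty_or_nonempty with h0 | ⟨w₀, hw₀⟩
  · rw [h0]
    exact ⟨Set.finite_empty, by simp; positivity⟩
  obtain ⟨hc, h1, h2⟩ := hw₀
  set l : ℤ × ℤ → ℝ := fun w => a * w.1 + b * w.2 with hl
  set m : ℤ × ℤ → ℝ := fun w => c * w.1 + d * w.2 with hm
  -- ρ is the size of `w₀` in the norm of the parallelogram. The determinant against `w₀` has at
  -- most 4αβρ nonzero values, each on a line carrying at most 4/ρ + 1 points; ρ cancels in the
  -- product, so any `w₀` serves. Determinant 0 leaves only ±`w₀`, by primitivity.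
  set ρ := max (|l w₀| / α) (|m w₀| / β) with hρ
  have hlρ : |l w₀| ≤ α * ρ := by
    have := le_max_left (|l w₀| / α) (|m w₀| / β)
    rw [← hρ, div_le_iff₀ hα] at this; linarith
  have hmρ : |m w₀| ≤ β * ρ := by
    have := le_max_right (|l w₀| / α) (|m w₀| / β)
    rw [← hρ, div_le_iff₀ hβ] at this; linarith
  have hρ1 : ρ ≤ 1 := max_le ((div_le_one hα).2 h1) ((div_le_one hβ).2 h2)
  have hρ0 : 0 < ρ := by
    by_contra hcon
    have hl0 : l w₀ = 0 := abs_nonpos_iff.1 (hlρ.trans (by nlinarith))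
    have hm0 : m w₀ = 0 := abs_nonpos_iff.1 (hmρ.trans (by nlinarith))
    have e1 : (w₀.1 : ℝ) = 0 := by
      simp only [hl, hm] at hl0 hm0
      linear_combination (-(w₀.1 : ℝ)) * hdet + d * hl0 - b * hm0
    have e2 : (w₀.2 : ℝ) = 0 := by
      simp only [hl, hm] at hl0 hm0
      linear_combination (-(w₀.2 : ℝ)) * hdet + a * hm0 - c * hl0
    have e1' : w₀.1 = 0 := by exact_mod_cast e1
    have e2' : w₀.2 = 0 := by exact_mod_cast e2
    rw [e1', e2'] at hc
    exact not_isCoprime_zero_zero hc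
  have hline : ∀ j : ℤ, CardLE {w | w ∈ A ∧ w₀.1 * w.2 - w₀.2 * w.1 = j} (2 * (2 / ρ) + 1) := by
    intro j
    refine CardLE.of_line (fun w k => (w.1 + k * w₀.1, w.2 + k * w₀.2)) (by positivity) ?_
    rintro v ⟨⟨-, hv1, hv2⟩, hvj⟩ w ⟨⟨-, hw1, hw2⟩, hwj⟩
    obtain ⟨k, rfl⟩ := exists_add_mul_of_det_eq hc (hvj.trans hwj.symm)
    refine ⟨k, rfl, ?_⟩
    rw [le_div_iff₀ hρ0]
    have e1 : |(k : ℝ)| * |l w₀| ≤ 2 * α := by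
      rw [← abs_mul]
      have : (k : ℝ) * l w₀ = (a * ((v.1 + k * w₀.1 : ℤ) : ℝ) + b * ((v.2 + k * w₀.2 : ℤ) : ℝ))
          - (a * v.1 + b * v.2) := by simp only [hl]; push_cast; ring
      rw [this]
      exact (abs_sub _ _).trans (by linarith)
    have e2 : |(k : ℝ)| * |m w₀| ≤ 2 * β := by
      rw [← abs_mul]
      have : (k : ℝ) * m w₀ = (c * ((v.1 + k * w₀.1 : ℤ) : ℝ) + d * ((v.2 + k * w₀.2 : ℤ) : ℝ))
          - (c * v.1 + d * v.2) := by simp only [hm]; push_cast; ring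
      rw [this]
      exact (abs_sub _ _).trans (by linarith)
    rw [hρ, mul_max_of_nonneg _ _ (abs_nonneg _)]
    refine max_le ?_ ?_
    · rw [mul_div_assoc', div_le_iff₀ hα]; exact e1
    · rw [mul_div_assoc', div_le_iff₀ hβ]; exact e2
  set n := ⌊2 * (α * β) * ρ⌋₊ with hn
  have hn' : (n : ℝ) ≤ 2 * (α * β) * ρ := Nat.floor_le (by positivity)
  have hzero : CardLE {w | w ∈ A ∧ w₀.1 * w.2 - w₀.2 * w.1 = 0} 2 := by
    refine (CardLE.of_finset {w₀, (-w₀.1, -w₀.2)}).mono ?_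
      (by exact_mod_cast Finset.card_le_two)
    rintro w ⟨⟨hw, -, -⟩, hj⟩
    obtain ⟨k, hk⟩ := exists_add_mul_of_det_eq (w := (0, 0)) (w' := w) hc (by simp [hj])
    simp only [zero_add] at hk
    have hu : IsUnit k := by
      rw [hk] at hw
      exact hw.isUnit_of_dvd' (dvd_mul_right _ _) (dvd_mul_right _ _)
    rcases Int.isUnit_iff.1 hu with h | h <;> subst h <;> simp [hk]
  have hmain := hzero.union (CardLE.biUnion ((Finset.Icc (-n : ℤ) n).erase 0)
    (fun j => {w | w ∈ A ∧ w₀.1 * w.2 - w₀.2 * w.1 = j}) _ fun j _ => hline j)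
  refine hmain.mono ?_ ?_
  · intro w hw
    by_cases hj : w₀.1 * w.2 - w₀.2 * w.1 = 0
    · exact Or.inl ⟨hw, hj⟩
    · right
      simp only [Set.mem_iUnion]
      refine ⟨w₀.1 * w.2 - w₀.2 * w.1, ?_, hw, rfl⟩
      rw [Finset.mem_erase, Finset.mem_Icc]
      refine ⟨hj, ?_⟩
      have hdetw : ((w₀.1 * w.2 - w₀.2 * w.1 : ℤ) : ℝ) = l w₀ * m w - m w₀ * l w := by
        simp only [hl, hm]; push_cast
        linear_combination (-((w₀.1 : ℝ) * w.2 - w₀.2 * w.1)) * hdet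
      have hb : |((w₀.1 * w.2 - w₀.2 * w.1 : ℤ) : ℝ)| ≤ 2 * (α * β) * ρ := by
        rw [hdetw]
        refine (abs_sub _ _).trans ?_
        rw [abs_mul, abs_mul]
        have := mul_le_mul hlρ hw.2.2 (abs_nonneg _) (by positivity)
        have := mul_le_mul hmρ hw.2.1 (abs_nonneg _) (by positivity)
        simp only [hl, hm] at *
        nlinarith
      have hnat : (w₀.1 * w.2 - w₀.2 * w.1).natAbs ≤ n := by
        apply Nat.le_floor
        rw [Nat.cast_natAbs, Int.cast_abs]
        exact hb
      omega
  · have hcard : (((Finset.Icc (-n : ℤ) n).erase 0).card : ℝ) = 2 * n := by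
      have : ((Finset.Icc (-n : ℤ) n).erase 0).card = 2 * n := by
        rw [Finset.card_erase_of_mem (by simp), Int.card_Icc]; omega
      rw [this]; push_cast; ring
    rw [hcard]
    have : 2 * (2 / ρ) + 1 ≤ 5 / ρ := by
      rw [← sub_nonneg]
      have : 5 / ρ - (2 * (2 / ρ) + 1) = (1 - ρ) / ρ := by field_simp; ring
      rw [this]; exact div_nonneg (by linarith) hρ0.le
    calc 2 + 2 * (n : ℝ) * (2 * (2 / ρ) + 1) ≤ 2 + 2 * (2 * (α * β) * ρ) * (5 / ρ) := by gcongr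
      _ = 2 + 20 * (α * β) := by field_simp; ring

/-! ### Binary cubic forms and their real normal form. -/

namespace Cubic

/-- Substitution `F(p X + r Y, q X + s Y)` in the binary cubic form
`F = a X³ + b X² Y + c X Y² + d Y³`. -/
def act {R : Type*} [CommRing R] (F : Cubic R) (p q r s : R) : Cubic R where
  a := F.a * p ^ 3 + F.b * p ^ 2 * q + F.c * p * q ^ 2 + F.d * q ^ 3
  b := 3 * F.a * p ^ 2 * r + F.b * (p ^ 2 * s + 2 * p * q * r)
    + F.c * (2 * p * q * s + q ^ 2 * r) + 3 * F.d * q ^ 2 * s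
  c := 3 * F.a * p * r ^ 2 + F.b * (r ^ 2 * q + 2 * p * r * s)
    + F.c * (p * s ^ 2 + 2 * q * r * s) + 3 * F.d * q * s ^ 2
  d := F.a * r ^ 3 + F.b * r ^ 2 * s + F.c * r * s ^ 2 + F.d * s ^ 3

lemma act_act_inv {R : Type*} [CommRing R] (F : Cubic R) {p q r s : R} (h : p * s - q * r = 1) :
    (F.act s (-q) (-r) p).act p q r s = F := by
  ext
  · simp only [act]
    linear_combination F.a * ((p * s - q * r) ^ 2 + (p * s - q * r) + 1) * h
  · simp only [act]
    linear_combination F.b * ((p * s - q * r) ^ 2 + (p * s - q * r) + 1) * h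
  · simp only [act]
    linear_combination F.c * ((p * s - q * r) ^ 2 + (p * s - q * r) + 1) * h
  · simp only [act]
    linear_combination F.d * ((p * s - q * r) ^ 2 + (p * s - q * r) + 1) * h

lemma act_act {R : Type*} [CommRing R] (F : Cubic R) (p q r s p' q' r' s' : R) :
    (F.act p q r s).act p' q' r' s' =
      F.act (p * p' + r * q') (q * p' + s * q') (p * r' + r * s') (q * r' + s * s') := by
  ext <;> simp only [act] <;> ring

/-- The binary form `F` equals `μ (x³ + σ x y²)` with `σ = ±1`, where `x = x₁ X + x₂ Y` and
`y = y₁ X + y₂ Y` is a unimodular real substitution. -/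
structure IsNormal (F : Cubic ℤ) (μ σ x₁ y₁ x₂ y₂ : ℝ) : Prop where
  det : x₁ * y₂ - y₁ * x₂ = 1
  sign : σ = 1 ∨ σ = -1
  a_eq : (F.a : ℝ) = μ * (x₁ ^ 3 + σ * x₁ * y₁ ^ 2)
  b_eq : (F.b : ℝ) = μ * (3 * x₁ ^ 2 * x₂ + σ * (x₂ * y₁ ^ 2 + 2 * x₁ * y₁ * y₂))
  c_eq : (F.c : ℝ) = μ * (3 * x₁ * x₂ ^ 2 + σ * (x₁ * y₂ ^ 2 + 2 * x₂ * y₁ * y₂))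
  d_eq : (F.d : ℝ) = μ * (x₂ ^ 3 + σ * x₂ * y₂ ^ 2)

namespace IsNormal

variable {F : Cubic ℤ} {μ σ x₁ y₁ x₂ y₂ : ℝ}

lemma act (h : IsNormal F μ σ x₁ y₁ x₂ y₂) {p q r s : ℤ} (hdet : p * s - q * r = 1) :
    IsNormal (F.act p q r s) μ σ (x₁ * p + x₂ * q) (y₁ * p + y₂ * q)
      (x₁ * r + x₂ * s) (y₁ * r + y₂ * s) where
  det := by
    have h' : (p : ℝ) * s - q * r = 1 := by exact_mod_cast hdet
    linear_combination ((p : ℝ) * s - q * r) * h.det + h'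
  sign := h.sign
  a_eq := by simp only [Cubic.act]; push_cast; rw [h.a_eq, h.b_eq, h.c_eq, h.d_eq]; ring
  b_eq := by simp only [Cubic.act]; push_cast; rw [h.a_eq, h.b_eq, h.c_eq, h.d_eq]; ring
  c_eq := by simp only [Cubic.act]; push_cast; rw [h.a_eq, h.b_eq, h.c_eq, h.d_eq]; ring
  d_eq := by simp only [Cubic.act]; push_cast; rw [h.a_eq, h.b_eq, h.c_eq, h.d_eq]; ring

lemma sign_sq (h : IsNormal F μ σ x₁ y₁ x₂ y₂) : σ ^ 2 = 1 := by
  rcases h.sign with h | h <;> rw [h] <;> norm_num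

lemma discr_eq (h : IsNormal F μ σ x₁ y₁ x₂ y₂) : (F.discr : ℝ) = -4 * σ * μ ^ 4 := by
  have hs := h.sign_sq
  have e : (F.discr : ℝ) = -4 * σ ^ 3 * μ ^ 4 * (x₁ * y₂ - y₁ * x₂) ^ 6 := by
    simp only [Cubic.discr]; push_cast; rw [h.a_eq, h.b_eq, h.c_eq, h.d_eq]; ring
  rw [e, h.det]
  linear_combination (-4 * σ * μ ^ 4) * hs

lemma abs_discr (h : IsNormal F μ σ x₁ y₁ x₂ y₂) : |(F.discr : ℝ)| = 4 * μ ^ 4 := by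
  have : |σ| = 1 := by rcases h.sign with h | h <;> rw [h] <;> norm_num
  rw [h.discr_eq, abs_mul, abs_mul, this, abs_of_nonneg (show (0 : ℝ) ≤ μ ^ 4 by positivity)]
  norm_num

/-- The left side is the leading coefficient of the Hessian covariant. It depends only on the first
column (x₁, y₁), as does the coefficient `a`, so the columns of a substitution can be bounded one at
a time. -/
lemma hessian_left (h : IsNormal F μ σ x₁ y₁ x₂ y₂) :
    (F.b : ℝ) ^ 2 - 3 * F.a * F.c = μ ^ 2 * (y₁ ^ 2 - 3 * σ * x₁ ^ 2) := by
  have hs := h.sign_sq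
  have e : (F.b : ℝ) ^ 2 - 3 * F.a * F.c
      = μ ^ 2 * (σ ^ 2 * y₁ ^ 2 - 3 * σ * x₁ ^ 2) * (x₁ * y₂ - y₁ * x₂) ^ 2 := by
    rw [h.a_eq, h.b_eq, h.c_eq]; ring
  rw [e, h.det, hs]; ring

lemma hessian_right (h : IsNormal F μ σ x₁ y₁ x₂ y₂) :
    (F.c : ℝ) ^ 2 - 3 * F.b * F.d = μ ^ 2 * (y₂ ^ 2 - 3 * σ * x₂ ^ 2) := by
  have hs := h.sign_sq
  have e : (F.c : ℝ) ^ 2 - 3 * F.b * F.d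
      = μ ^ 2 * (σ ^ 2 * y₂ ^ 2 - 3 * σ * x₂ ^ 2) * (x₁ * y₂ - y₁ * x₂) ^ 2 := by
    rw [h.b_eq, h.c_eq, h.d_eq]; ring
  rw [e, h.det, hs]; ring

end IsNormal

/-- All coefficients of `F` are at most `H` in absolute value. -/
def HeightLE (F : Cubic ℤ) (H : ℝ) : Prop :=
  |(F.a : ℝ)| ≤ H ∧ |(F.b : ℝ)| ≤ H ∧ |(F.c : ℝ)| ≤ H ∧ |(F.d : ℝ)| ≤ H

end Cubic

/-! ### Counting forms of bounded height in one orbit. -/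

/-- A vector near a root direction of `x (x² + σ y²)`, and not too long. -/
def NearRoot (K x y : ℝ) : Prop :=
  max |x| |y| ≤ 4 * K ∧
    ∃ i ∈ ({0, 1, -1} : Finset ℤ), |x - i * y| * max |x| |y| ^ 2 ≤ 2 * K

/-- For σ = 1 the only real root line is x = 0 and the other factor is x² + y²; the cubic bounds
|x|, and the Hessian then bounds |y|. For σ = -1 the Hessian is definite and bounds the whole
vector; of the factors x, x - y, x + y, two are comparable to or larger than max(|x|, |y|), so the
third carries the smallness. -/
lemma nearRoot_of_form_le {σ K x y : ℝ} (hσ : σ = 1 ∨ σ = -1) (hK : 1 ≤ 2 * K)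
    (h1 : |x ^ 3 + σ * x * y ^ 2| ≤ K) (h2 : |y ^ 2 - 3 * σ * x ^ 2| ≤ 4 * K ^ 2) :
    NearRoot K x y := by
  have hx2 : |x| ^ 2 = x ^ 2 := sq_abs x
  have hy2 : |y| ^ 2 = y ^ 2 := sq_abs y
  have hx0 := abs_nonneg x
  have hy0 := abs_nonneg y
  have hmax : max |x| |y| ^ 2 ≤ x ^ 2 + y ^ 2 := by
    rcases max_cases |x| |y| with h | h <;> rw [h.1] <;> nlinarith
  have h2' := (abs_le.1 h2).2
  rcases hσ with rfl | rfl
  · have h1' : |x| * (x ^ 2 + y ^ 2) ≤ K := by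
      have : x ^ 3 + 1 * x * y ^ 2 = x * (x ^ 2 + y ^ 2) := by ring
      rwa [this, abs_mul, abs_of_nonneg (by positivity : 0 ≤ x ^ 2 + y ^ 2)] at h1
    have hx : |x| ≤ 2 * K := by
      by_contra hcon
      push Not at hcon
      have a1 : 1 ≤ |x| := by linarith
      have a2 : 1 ≤ x ^ 2 + y ^ 2 := by nlinarith [sq_nonneg y]
      nlinarith
    refine ⟨?_, 0, by simp, ?_⟩
    · have : |y| ≤ 4 * K := by
        apply abs_le_of_sq_le_sq' _ (by linarith) |> abs_le.2
        nlinarith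
      exact max_le (by linarith) this
    · simp only [Int.cast_zero, zero_mul, sub_zero]
      nlinarith
  · have hx : |x| ≤ 2 * K := abs_le.2 (abs_le_of_sq_le_sq' (by nlinarith [sq_nonneg y]) (by linarith))
    have hy : |y| ≤ 2 * K := abs_le.2 (abs_le_of_sq_le_sq' (by nlinarith [sq_nonneg x]) (by linarith))
    refine ⟨max_le (by linarith) (by linarith), ?_⟩
    have h1' : |x| * (|x - y| * |x + y|) ≤ K := by
      rw [← abs_mul, ← abs_mul]
      rwa [show x * ((x - y) * (x + y)) = x ^ 3 + -1 * x * y ^ 2 by ring]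
    by_cases hcase : 2 * |x| ≤ |y|
    · refine ⟨0, by simp, ?_⟩
      simp only [Int.cast_zero, zero_mul, sub_zero]
      rw [max_eq_right (by linarith), hy2]
      have : y ^ 2 ≤ 2 * (|x - y| * |x + y|) := by
        rw [← abs_mul]
        have := neg_abs_le ((x - y) * (x + y))
        nlinarith
      nlinarith
    · push Not at hcase
      set M := max |x| |y| with hM
      have hM0 : 0 ≤ M := le_max_of_le_left hx0
      have hMx : M ≤ 2 * |x| := max_le (by linarith) hcase.le
      rcases le_total 0 (x * y) with hxy | hxy
      · refine ⟨1, by simp, ?_⟩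
        have e : |x + y| = |x| + |y| := abs_add_eq_add_abs_iff x y |>.2 (by
          rcases mul_nonneg_iff.1 hxy with h | h
          · exact Or.inl h
          · exact Or.inr h)
        have hMs : M ≤ |x + y| := by rw [e]; exact max_le (by linarith) (by linarith)
        have : M ^ 2 ≤ 2 * (|x| * |x + y|) := by nlinarith
        have := mul_le_mul_of_nonneg_left this (abs_nonneg (x - y))
        simp only [Int.cast_one, one_mul]
        nlinarith
      · refine ⟨-1, by simp, ?_⟩
        have e : |x - y| = |x| + |y| := by
          have := abs_add_eq_add_abs_iff x (-y) |>.2 (by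
            rcases mul_nonpos_iff.1 hxy with h | h
            · exact Or.inl ⟨h.1, by linarith [h.2]⟩
            · exact Or.inr ⟨h.1, by linarith [h.2]⟩)
          rwa [abs_neg, ← sub_eq_add_neg] at this
        have hMs : M ≤ |x - y| := by rw [e]; exact max_le (by linarith) (by linarith)
        have : M ^ 2 ≤ 2 * (|x| * |x - y|) := by nlinarith
        have := mul_le_mul_of_nonneg_left this (abs_nonneg (x + y))
        have e2 : x - ((-1 : ℤ) : ℝ) * y = x + y := by push_cast; ring
        rw [e2]
        nlinarith

lemma exists_dyadic_scale {M t : ℝ} {L : ℕ} (h : M ≤ 2 ^ L * t) :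
    ∃ j ≤ L, M ≤ 2 ^ j * t ∧ (j = 0 ∨ 2 ^ j * t ≤ 2 * M) := by
  classical
  have hex : ∃ j, M ≤ 2 ^ j * t := ⟨L, h⟩
  refine ⟨Nat.find hex, Nat.find_min' hex h, Nat.find_spec hex, ?_⟩
  rcases Nat.eq_zero_or_pos (Nat.find hex) with h0 | h0
  · exact Or.inl h0
  · right
    have := Nat.find_min hex (Nat.sub_lt h0 one_pos)
    obtain ⟨k, hk⟩ := Nat.exists_eq_succ_of_ne_zero h0.ne'
    rw [hk] at this ⊢
    simp only [Nat.succ_eq_add_one, Nat.add_sub_cancel, not_le] at this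
    rw [Nat.succ_eq_add_one, pow_succ]
    linarith

/-- Vectors of length about 2^j t near a given root line lie in a parallelogram of area O(t²/2^j),
and lengths reach at most 4t³ ≤ 2^L t. Every area is crudely bounded by its value at j = 0.
Primitivity keeps the count at O(1 + area) for long thin parallelograms. -/
lemma cardLE_primitive_nearRoot {x₁ y₁ x₂ y₂ t : ℝ} {L : ℕ} (hdet : x₁ * y₂ - y₁ * x₂ = 1)
    (ht : 0 < t) (hL : 4 * t ^ 2 ≤ 2 ^ L) :
    CardLE {w : ℤ × ℤ | IsCoprime w.1 w.2 ∧
      NearRoot (t ^ 3) (x₁ * w.1 + x₂ * w.2) (y₁ * w.1 + y₂ * w.2)}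
      (3 * ((L + 1) * (2 + 160 * t ^ 2))) := by
  have key := CardLE.biUnion ({0, 1, -1} : Finset ℤ) _ _ fun i _ =>
    CardLE.biUnion (Finset.range (L + 1)) _ (2 + 160 * t ^ 2) fun j _ =>
      (cardLE_primitive_parallelogram (a := x₁ - i * y₁) (b := x₂ - i * y₂) (c := y₁) (d := y₂)
        (α := 8 * t / 4 ^ j) (β := 2 ^ j * t) (by linear_combination hdet) (by positivity)
        (by positivity)).mono le_rfl (by
          have e : 8 * t / 4 ^ j * (2 ^ j * t) = 8 * t ^ 2 * (1 / 2 ^ j) := by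
            rw [show (4 : ℝ) = 2 * 2 by norm_num, mul_pow]; field_simp
          have : 1 / (2 : ℝ) ^ j ≤ 1 := by
            rw [div_le_one (by positivity)]; exact one_le_pow₀ (by norm_num)
          rw [e]
          have := mul_le_mul_of_nonneg_left this (show 0 ≤ 8 * t ^ 2 by positivity)
          linarith)
  refine key.mono ?_ ?_
  · rintro w ⟨hw, hM, i, hi, hℓ⟩
    set x := x₁ * w.1 + x₂ * w.2 with hx
    set y := y₁ * w.1 + y₂ * w.2 with hy
    set M := max |x| |y| with hMdef
    have hxM : |x| ≤ M := le_max_left _ _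
    have hyM : |y| ≤ M := le_max_right _ _
    have hML : M ≤ 2 ^ L * t := by nlinarith
    obtain ⟨j, hj, hj1, hj2⟩ := exists_dyadic_scale hML
    simp only [Set.mem_iUnion]
    refine ⟨i, hi, j, by simpa using Nat.lt_succ_of_le hj, hw, ?_, ?_⟩
    · have e : (x₁ - i * y₁) * (w.1 : ℝ) + (x₂ - i * y₂) * w.2 = x - i * y := by
        rw [hx, hy]; ring
      rw [e, le_div_iff₀ (by positivity)]
      rcases hj2 with rfl | hj2
      · have hi1 : |(i : ℝ)| ≤ 1 := by
          simp only [Finset.mem_insert, Finset.mem_singleton] at hi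
          rcases hi with rfl | rfl | rfl <;> norm_num
        have : |x - i * y| ≤ |x| + |(i : ℝ)| * |y| := by
          rw [← abs_mul]; exact abs_sub _ _
        have : |(i : ℝ)| * |y| ≤ 1 * |y| := by gcongr
        simp only [pow_zero] at *
        linarith
      · have h4 : (4 : ℝ) ^ j = 2 ^ j * 2 ^ j := by
          rw [← mul_pow]; norm_num
        have hsq : (2 ^ j * t) ^ 2 ≤ (2 * M) ^ 2 := by gcongr
        have := mul_le_mul_of_nonneg_left hsq (abs_nonneg (x - i * y))
        rw [h4]
        have h3 : (|x - i * y| * (2 ^ j * 2 ^ j)) * t ^ 2 ≤ (8 * t) * t ^ 2 := by nlinarith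
        exact le_of_mul_le_mul_right h3 (by positivity)
    · exact hyM.trans hj1
  · have : (({0, 1, -1} : Finset ℤ).card : ℝ) = 3 := by norm_num
    rw [this]
    simp

/-- Oriented bases of `ℤ²` with both members in a given set, on which lengths are measured after
a unimodular real substitution: there are at most ten times as many as elements of the set. -/
lemma cardLE_unimodular_pairs {x₁ y₁ x₂ y₂ B : ℝ} (hdet : x₁ * y₂ - y₁ * x₂ = 1)
    {W : Set (ℤ × ℤ)} (hW : CardLE W B) :
    CardLE {v : (ℤ × ℤ) × (ℤ × ℤ) | v.1 ∈ W ∧ v.2 ∈ W ∧ v.1.1 * v.2.2 - v.1.2 * v.2.1 = 1}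
      (10 * B) := by
  set M : ℤ × ℤ → ℝ := fun w => max |x₁ * w.1 + x₂ * w.2| |y₁ * w.1 + y₂ * w.2| with hM
  have hMpos : ∀ v w : ℤ × ℤ, v.1 * w.2 - v.2 * w.1 = 1 → 0 < M v := by
    intro v w h
    by_contra hcon
    have h1 : x₁ * v.1 + x₂ * v.2 = 0 :=
      abs_nonpos_iff.1 ((le_max_left _ _).trans (not_lt.1 hcon))
    have h2 : y₁ * v.1 + y₂ * v.2 = 0 :=
      abs_nonpos_iff.1 ((le_max_right _ _).trans (not_lt.1 hcon))
    have h' : (v.1 : ℝ) * w.2 - v.2 * w.1 = 1 := by exact_mod_cast h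
    have : (0 : ℝ) = 1 := by
      linear_combination h' + ((v.1 : ℝ) * w.2 - v.2 * w.1) * hdet
        - (y₁ * w.1 + y₂ * w.2) * h1 + (x₁ * w.1 + x₂ * w.2) * h2
    norm_num at this
  -- For fixed `v` the solutions `w` differ by multiples of `v`; those no longer than `v` have
  -- multipliers at most 2 apart in absolute value.
  have hfib : ∀ v : ℤ × ℤ,
      CardLE {w | v.1 * w.2 - v.2 * w.1 = 1 ∧ M w ≤ M v} (2 * 2 + 1) := by
    intro v
    refine CardLE.of_line (fun w k => (w.1 + k * v.1, w.2 + k * v.2)) (by norm_num) ?_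
    rintro w ⟨hw, hwM⟩ w' ⟨hw', hwM'⟩
    have hv : IsCoprime v.1 v.2 := ⟨w.2, -w.1, by linear_combination hw⟩
    obtain ⟨k, rfl⟩ := exists_add_mul_of_det_eq hv (hw.trans hw'.symm)
    refine ⟨k, rfl, ?_⟩
    refine le_of_mul_le_mul_right ?_ (hMpos v w hw)
    have hgen : ∀ a b : ℝ, |a * w.1 + b * w.2| ≤ M v →
        |a * ((w.1 + k * v.1 : ℤ) : ℝ) + b * ((w.2 + k * v.2 : ℤ) : ℝ)| ≤ M v →
        |(k : ℝ)| * |a * v.1 + b * v.2| ≤ 2 * M v := by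
      intro a b h1 h2
      rw [← abs_mul]
      have : (k : ℝ) * (a * v.1 + b * v.2) = (a * ((w.1 + k * v.1 : ℤ) : ℝ)
          + b * ((w.2 + k * v.2 : ℤ) : ℝ)) - (a * w.1 + b * w.2) := by push_cast; ring
      rw [this]
      exact (abs_sub _ _).trans (by linarith)
    have e : M v = max |x₁ * v.1 + x₂ * v.2| |y₁ * v.1 + y₂ * v.2| := rfl
    conv_lhs => rw [e, mul_max_of_nonneg _ _ (abs_nonneg _)]
    exact max_le
      (hgen _ _ ((le_max_left _ _).trans hwM) ((le_max_left _ _).trans hwM'))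
      (hgen _ _ ((le_max_right _ _).trans hwM) ((le_max_right _ _).trans hwM'))
  have h1 := CardLE.biUnion_set hW _ (by norm_num) fun v _ => (hfib v).image (fun w => (v, w))
  -- When the second column is the longer one, the rotation (v, w) ↦ (w, -v) preserves the
  -- determinant and exchanges the roles.
  have h2 := CardLE.biUnion_set hW _ (by norm_num) fun v _ =>
    (hfib v).image (fun w => ((-w.1, -w.2), v))
  refine (h1.union h2).mono ?_ (by linarith)
  rintro ⟨v, w⟩ ⟨hv, hw, hvw⟩
  simp only [Set.mem_union, Set.mem_iUnion]
  rcases le_total (M w) (M v) with h | h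
  · exact Or.inl ⟨v, hv, w, ⟨hvw, h⟩, rfl⟩
  · refine Or.inr ⟨w, hw, (-v.1, -v.2), ⟨?_, ?_⟩, by simp⟩
    · simp only at hvw ⊢; linear_combination hvw
    · have : M (-v.1, -v.2) = M v := by
        simp only [hM]; push_cast
        rw [← abs_neg (x₁ * (v.1 : ℝ) + x₂ * v.2), ← abs_neg (y₁ * (v.1 : ℝ) + y₂ * v.2)]
        ring_nf
      rw [this]; exact h

namespace Cubic

/-- The number of forms of height at most `H` in a fixed `SL₂(ℤ)`-orbit. -/
lemma cardLE_orbit {F : Cubic ℤ} {μ σ x₁ y₁ x₂ y₂ H t : ℝ} {L : ℕ}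
    (h : IsNormal F μ σ x₁ y₁ x₂ y₂) (hμ : μ ≠ 0) (ht : 0 < t) (hH : H ≤ |μ| * t ^ 3)
    (ht3 : 1 ≤ 2 * t ^ 3) (hL : 4 * t ^ 2 ≤ 2 ^ L) :
    CardLE {f : Cubic ℤ | f.HeightLE H ∧
      ∃ p q r s : ℤ, p * s - q * r = 1 ∧ f = F.act p q r s}
      (30 * ((L + 1) * (2 + 160 * t ^ 2))) := by
  have hP := cardLE_unimodular_pairs h.det (cardLE_primitive_nearRoot h.det ht hL)
  refine (hP.image fun v => F.act v.1.1 v.1.2 v.2.1 v.2.2).mono ?_ (by linarith)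
  rintro f ⟨⟨ha, hb, hc, hd⟩, p, q, r, s, hpq, rfl⟩
  have hN := h.act hpq
  have hμ' : 0 < |μ| := abs_pos.2 hμ
  have hμ2 : μ ^ 2 = |μ| ^ 2 := (sq_abs μ).symm
  have hform : ∀ u : ℝ, |μ * u| ≤ H → |u| ≤ t ^ 3 := by
    intro u hu
    rw [abs_mul] at hu
    exact le_of_mul_le_mul_left (hu.trans hH) hμ'
  -- The 4 is 1 + 3, from |b² - 3ac| ≤ H² + 3H².
  have hhess : ∀ a b c u : ℝ, |a| ≤ H → |b| ≤ H → |c| ≤ H → b ^ 2 - 3 * a * c = μ ^ 2 * u →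
      |u| ≤ 4 * (t ^ 3) ^ 2 := by
    intro a b c u ha hb hc hu
    have hH0 : 0 ≤ H := (abs_nonneg a).trans ha
    have h1 : |a| * |c| ≤ H * H := by gcongr
    have h2 : |b| ^ 2 ≤ H ^ 2 := by gcongr
    have h3 : μ ^ 2 * |u| ≤ 4 * H ^ 2 := by
      have : μ ^ 2 * |u| = |b ^ 2 - 3 * a * c| := by
        rw [hu, abs_mul, abs_of_nonneg (sq_nonneg μ)]
      rw [this]
      refine (abs_sub _ _).trans ?_
      rw [abs_mul, abs_mul, abs_pow, abs_of_nonneg (show (0 : ℝ) ≤ 3 by norm_num)]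
      nlinarith
    have h4 : H ^ 2 ≤ (|μ| * t ^ 3) ^ 2 := by gcongr
    have h5 : |μ| ^ 2 * |u| ≤ |μ| ^ 2 * (4 * (t ^ 3) ^ 2) := by rw [← hμ2]; nlinarith
    exact le_of_mul_le_mul_left h5 (by positivity)
  refine ⟨((p, q), (r, s)), ⟨⟨⟨s, -r, by linear_combination hpq⟩, ?_⟩,
    ⟨⟨-q, p, by linear_combination hpq⟩, ?_⟩, hpq⟩, rfl⟩
  · refine nearRoot_of_form_le h.sign ht3 (hform _ ?_) (hhess _ _ _ _ ha hb hc hN.hessian_left)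
    rw [← hN.a_eq]; exact ha
  · refine nearRoot_of_form_le h.sign ht3 (hform _ ?_) (hhess _ _ _ _ hb hc hd ?_)
    · rw [← hN.d_eq]; exact hd
    · exact hN.hessian_right

end Cubic

/-! ### Existence of the normal form. -/

lemma exists_root_monic_cubic (b c d : ℝ) : ∃ x : ℝ, x ^ 3 + b * x ^ 2 + c * x + d = 0 := by
  set R := 1 + |b| + |c| + |d| with hR
  have hb := abs_nonneg b
  have hc := abs_nonneg c
  have hd := abs_nonneg d
  have hR1 : 1 ≤ R := by linarith
  have hb1 := neg_abs_le b
  have hb2 := le_abs_self b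
  have hc1 := neg_abs_le c
  have hc2 := le_abs_self c
  have hd1 := neg_abs_le d
  have hd2 := le_abs_self d
  have hRR : R ≤ R ^ 2 := by nlinarith
  have e : R ^ 3 = R ^ 2 + |b| * R ^ 2 + |c| * R ^ 2 + |d| * R ^ 2 := by
    have : R ^ 3 = R * R ^ 2 := by ring
    rw [this]; nth_rewrite 1 [hR]; ring
  have k1 : |c| * R ≤ |c| * R ^ 2 := by gcongr
  have k2 : |d| * 1 ≤ |d| * R ^ 2 := by gcongr; linarith
  have l1 : -(|b| * R ^ 2) ≤ b * R ^ 2 := by nlinarith [sq_nonneg R]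
  have l2 : b * R ^ 2 ≤ |b| * R ^ 2 := by gcongr
  have l3 : -(|c| * R) ≤ c * R := by nlinarith
  have l4 : c * R ≤ |c| * R := by gcongr
  have hcont : ContinuousOn (fun x : ℝ => x ^ 3 + b * x ^ 2 + c * x + d) (Set.Icc (-R) R) := by
    fun_prop
  obtain ⟨x, -, hx⟩ := intermediate_value_Icc (by linarith : -R ≤ R) hcont
    (show (0 : ℝ) ∈ _ by constructor <;> nlinarith)
  exact ⟨x, hx⟩

namespace Cubic

/-- With a real root α and ξ = X - αY, the form is ξ(aξ² + BξY + CY²), where C ≠ 0 because the root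
is simple. Completing the square in Y gives ξ(Eξ² + Cη²); rescaling ξ by 1/s and η by s, with s⁴ =
|C/E|, equalises the two coefficients up to sign. -/
lemma exists_isNormal {F : Cubic ℤ} (ha : F.a ≠ 0) (hD : F.discr ≠ 0) :
    ∃ μ σ x₁ y₁ x₂ y₂ : ℝ, IsNormal F μ σ x₁ y₁ x₂ y₂ := by
  obtain ⟨a, b, c, d⟩ := F
  simp only at ha
  have ha' : (a : ℝ) ≠ 0 := by exact_mod_cast ha
  obtain ⟨α, hα⟩ := exists_root_monic_cubic (b / a) (c / a) (d / a)
  have hα' : (a : ℝ) * α ^ 3 + b * α ^ 2 + c * α + d = 0 := by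
    field_simp at hα; linear_combination hα
  have hd : (d : ℝ) = -(a * α ^ 3 + b * α ^ 2 + c * α) := by linear_combination hα'
  set B : ℝ := 3 * a * α + b with hB
  set C : ℝ := 3 * a * α ^ 2 + 2 * b * α + c with hC
  have hbB : (b : ℝ) = B - 3 * a * α := by rw [hB]; ring
  have hcC : (c : ℝ) = C - 2 * B * α + 3 * a * α ^ 2 := by rw [hC, hB]; ring
  have hDreal : ((Cubic.discr ⟨a, b, c, d⟩ : ℤ) : ℝ) = C ^ 2 * (B ^ 2 - 4 * a * C) := by
    simp only [Cubic.discr]; push_cast; rw [hd, hbB, hcC]; ring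
  have hD' : ((Cubic.discr ⟨a, b, c, d⟩ : ℤ) : ℝ) ≠ 0 := by exact_mod_cast hD
  rw [hDreal] at hD'
  have hC0 : C ≠ 0 := by rintro h; simp [h] at hD'
  set E : ℝ := a - B ^ 2 / (4 * C) with hE
  have hE0 : E ≠ 0 := by
    intro h
    apply hD'
    have : B ^ 2 - 4 * a * C = -4 * C * E := by rw [hE]; field_simp; ring
    rw [this, h]; ring
  have hpos : 0 < |C / E| := abs_pos.2 (div_ne_zero hC0 hE0)
  obtain ⟨s, hs0, hs⟩ : ∃ s : ℝ, 0 < s ∧ s ^ 4 = |C / E| := by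
    refine ⟨|C / E| ^ (1 / 4 : ℝ), Real.rpow_pos_of_pos hpos _, ?_⟩
    rw [← Real.rpow_natCast, ← Real.rpow_mul hpos.le]
    norm_num
  have hsne := hs0.ne'
  obtain ⟨σ, hσ, hσC⟩ : ∃ σ : ℝ, (σ = 1 ∨ σ = -1) ∧ E * s ^ 4 * σ = C := by
    rcases abs_choice (C / E) with h | h
    · refine ⟨1, Or.inl rfl, ?_⟩
      rw [hs, h]; field_simp
    · refine ⟨-1, Or.inr rfl, ?_⟩
      rw [hs, h]; field_simp
  have haE : (a : ℝ) = E + B ^ 2 / (4 * C) := by rw [hE]; ring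
  have e1 : (a : ℝ) = E * s ^ 3 * ((1 / s) ^ 3 + σ * (1 / s) * (s * (B / (2 * C))) ^ 2) := by
    have : E * s ^ 3 * ((1 / s) ^ 3 + σ * (1 / s) * (s * (B / (2 * C))) ^ 2)
        = E + (E * s ^ 4 * σ) * (B / (2 * C)) ^ 2 := by field_simp
    rw [this, hσC, haE]; field_simp; ring
  refine ⟨E * s ^ 3, σ, 1 / s, s * (B / (2 * C)), -α / s, s * (1 - B / (2 * C) * α),
    ?_, hσ, e1, ?_, ?_, ?_⟩
  · field_simp; ring
  · have : E * s ^ 3 * (3 * (1 / s) ^ 2 * (-α / s) + σ * (-α / s * (s * (B / (2 * C))) ^ 2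
        + 2 * (1 / s) * (s * (B / (2 * C))) * (s * (1 - B / (2 * C) * α))))
        = -3 * α * E + (E * s ^ 4 * σ) * (-α * (B / (2 * C)) ^ 2
          + 2 * (B / (2 * C)) * (1 - B / (2 * C) * α)) := by field_simp
    simp only
    rw [this, hσC, hbB, haE]; field_simp; ring
  · have : E * s ^ 3 * (3 * (1 / s) * (-α / s) ^ 2 + σ * (1 / s * (s * (1 - B / (2 * C) * α)) ^ 2
        + 2 * (-α / s) * (s * (B / (2 * C))) * (s * (1 - B / (2 * C) * α))))
        = 3 * α ^ 2 * E + (E * s ^ 4 * σ) * ((1 - B / (2 * C) * α) ^ 2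
          - 2 * α * (B / (2 * C)) * (1 - B / (2 * C) * α)) := by field_simp; ring
    simp only
    rw [this, hσC, hcC, haE]; field_simp; ring
  · have : E * s ^ 3 * ((-α / s) ^ 3 + σ * (-α / s) * (s * (1 - B / (2 * C) * α)) ^ 2)
        = -α ^ 3 * E + (E * s ^ 4 * σ) * (-α * (1 - B / (2 * C) * α) ^ 2) := by field_simp
    simp only
    rw [this, hσC, hd, hbB, hcC, haE]; field_simp; ring

end Cubic

/-! ### Reduction of lattices and of forms. -/

/-- Gauss reduction of a unimodular lattice in the plane. -/
lemma exists_reduced_basis {x₁ y₁ x₂ y₂ : ℝ} (hdet : x₁ * y₂ - y₁ * x₂ = 1) :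
    ∃ p q r s : ℤ, p * s - q * r = 1 ∧
      (x₁ * p + x₂ * q) ^ 2 + (y₁ * p + y₂ * q) ^ 2
        ≤ (x₁ * r + x₂ * s) ^ 2 + (y₁ * r + y₂ * s) ^ 2 ∧
      ((x₁ * p + x₂ * q) ^ 2 + (y₁ * p + y₂ * q) ^ 2)
        * ((x₁ * r + x₂ * s) ^ 2 + (y₁ * r + y₂ * s) ^ 2) ≤ 4 / 3 := by
  have hN : 0 < x₁ * x₁ + y₁ * y₁ := by
    by_contra h
    have h1 : x₁ = 0 := by nlinarith [sq_nonneg x₁, sq_nonneg y₁]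
    have h2 : y₁ = 0 := by nlinarith [sq_nonneg x₁, sq_nonneg y₁]
    rw [h1, h2] at hdet; norm_num at hdet
  -- Complex conjugation and the sign in -W₂/W₁ place the quotient in the upper half-plane, so that
  -- the fundamental domain of the modular group applies.
  set W₁ : ℂ := ⟨x₁, -y₁⟩ with hW₁
  set W₂ : ℂ := ⟨x₂, -y₂⟩ with hW₂
  have hW₁0 : W₁ ≠ 0 := by
    intro h
    have e1 := congrArg Complex.re h
    have e2 := congrArg Complex.im h
    simp [hW₁] at e1 e2
    rw [e1, e2] at hN; norm_num at hN
  have him : 0 < (-W₂ / W₁).im := by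
    rw [Complex.div_im]
    simp only [hW₁, hW₂, Complex.neg_re, Complex.neg_im, Complex.normSq_mk]
    have : (-(-y₂) * x₁ / (x₁ * x₁ + -y₁ * -y₁) - -x₂ * -y₁ / (x₁ * x₁ + -y₁ * -y₁))
        = 1 / (x₁ * x₁ + y₁ * y₁) := by
      rw [← hdet, ← sub_div]; ring_nf
    rw [this]; positivity
  obtain ⟨g, hg⟩ := ModularGroup.exists_smul_mem_fd ⟨-W₂ / W₁, him⟩
  set A := g 0 0 with hA
  set B := g 0 1 with hB
  set C := g 1 0 with hC
  set D := g 1 1 with hD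
  have hdetg : A * D - B * C = 1 := by
    have := g.det_coe
    rwa [Matrix.det_fin_two] at this
  set V₁ : ℂ := D * W₁ - C * W₂ with hV₁
  set V₂ : ℂ := -(B * W₁) + A * W₂ with hV₂
  have hcoe : ((g • (⟨-W₂ / W₁, him⟩ : UpperHalfPlane) : UpperHalfPlane) : ℂ) = -V₂ / V₁ := by
    rw [UpperHalfPlane.specialLinearGroup_apply]
    simp only [eq_intCast, Complex.ofReal_intCast]
    rw [← hA, ← hB, ← hC, ← hD]
    rw [← mul_div_mul_right _ _ hW₁0]
    congr 1 <;> (rw [add_mul, mul_assoc, div_mul_cancel₀ _ hW₁0]) <;> simp only [hV₁, hV₂] <;> ring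
  obtain ⟨h1, h2⟩ := hg
  rw [hcoe] at h1
  have h2' : |(-V₂ / V₁).re| ≤ 1 / 2 := by rw [← hcoe]; exact h2
  have v1r : V₁.re = x₁ * D + x₂ * (-C : ℤ) := by simp [hV₁, hW₁, hW₂]; ring
  have v1i : V₁.im = -(y₁ * D + y₂ * (-C : ℤ)) := by simp [hV₁, hW₁, hW₂]; ring
  have v2r : V₂.re = x₁ * (-B : ℤ) + x₂ * A := by simp [hV₂, hW₁, hW₂]; ring
  have v2i : V₂.im = -(y₁ * (-B : ℤ) + y₂ * A) := by simp [hV₂, hW₁, hW₂]; ring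
  have hdg : (A : ℝ) * D - B * C = 1 := by exact_mod_cast hdetg
  have hdV : V₁.re * V₂.im - V₁.im * V₂.re = -1 := by
    rw [v1r, v1i, v2r, v2i]; push_cast
    linear_combination (-((A : ℝ) * D - B * C)) * hdet - hdg
  set N₁ := Complex.normSq V₁ with hN₁
  set N₂ := Complex.normSq V₂ with hN₂
  have hN₁e : N₁ = V₁.re ^ 2 + V₁.im ^ 2 := by rw [hN₁, Complex.normSq_apply]; ring
  have hN₂e : N₂ = V₂.re ^ 2 + V₂.im ^ 2 := by rw [hN₂, Complex.normSq_apply]; ring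
  have hV₁0 : V₁ ≠ 0 := by
    intro h; rw [h] at hdV; simp at hdV
  have hN₁0 : 0 < N₁ := Complex.normSq_pos.2 hV₁0
  have hle : N₁ ≤ N₂ := by
    rw [Complex.normSq_div, Complex.normSq_neg, le_div_iff₀ hN₁0] at h1
    linarith
  have hdot : |V₁.re * V₂.re + V₁.im * V₂.im| ≤ N₁ / 2 := by
    have : (-V₂ / V₁).re = -(V₁.re * V₂.re + V₁.im * V₂.im) / N₁ := by
      rw [Complex.div_re]; simp only [Complex.neg_re, Complex.neg_im]; ring
    rw [this, abs_div, abs_neg, abs_of_pos hN₁0, div_le_iff₀ hN₁0] at h2'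
    linarith
  -- Lagrange's identity with determinant ±1. As the inner product is at most N₁/2 and N₁ ≤ N₂, it
  -- gives N₁N₂ ≤ 1 + N₁N₂/4.
  have hprod : N₁ * N₂ = 1 + (V₁.re * V₂.re + V₁.im * V₂.im) ^ 2 := by
    rw [hN₁e, hN₂e]
    linear_combination (V₁.re * V₂.im - V₁.im * V₂.re - 1) * hdV
  have hsq : (V₁.re * V₂.re + V₁.im * V₂.im) ^ 2 ≤ (N₁ / 2) ^ 2 := sq_le_sq' (abs_le.1 hdot).1 (abs_le.1 hdot).2
  have hfin : N₁ * N₂ ≤ 4 / 3 := by nlinarith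
  have g1 : N₁ = (x₁ * D + x₂ * (-C : ℤ)) ^ 2 + (y₁ * D + y₂ * (-C : ℤ)) ^ 2 := by
    rw [hN₁e, v1r, v1i]; ring
  have g2 : N₂ = (x₁ * (-B : ℤ) + x₂ * A) ^ 2 + (y₁ * (-B : ℤ) + y₂ * A) ^ 2 := by
    rw [hN₂e, v2r, v2i]; ring
  exact ⟨D, -C, -B, A, by linear_combination hdetg, by rw [← g1, ← g2]; exact hle,
    by rw [← g1, ← g2]; exact hfin⟩

/-! ### Counting reduced forms. -/

namespace Cubic

/-- Reduced forms with nonzero leading coefficient, in the cusp region of size `2 ^ j`. -/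
def reducedBox (lam : ℝ) (j : ℕ) : Set (Cubic ℤ) :=
  {F | F.a ≠ 0 ∧ |(F.a : ℝ)| ≤ 48 * lam / (2 ^ j) ^ 3 ∧ |(F.b : ℝ)| ≤ 48 * lam / 2 ^ j ∧
    |(F.c : ℝ)| ≤ 48 * lam * 2 ^ j ∧ |(F.d : ℝ)| ≤ 48 * lam * (2 ^ j) ^ 3}

/-- Reduced forms with vanishing leading coefficient and discriminant at most `X`. -/
def reducedCusp (X : ℝ) : Set (Cubic ℤ) :=
  {F | F.a = 0 ∧ F.b ≠ 0 ∧ |F.c| ≤ |F.b| ∧ |(F.discr : ℝ)| ≤ X}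

/-- The powers of 2^j cancel in the volume. A nonzero integer `a` in the box makes its shortest side
bound at least 1, hence all four, so the number of points is at most a constant times the volume. -/
lemma cardLE_reducedBox {lam : ℝ} (hlam : 0 < lam) (j : ℕ) :
    CardLE (reducedBox lam j) (144 ^ 4 * lam ^ 4) := by
  rcases (reducedBox lam j).eq_empty_or_nonempty with h0 | ⟨F, hF, hFa, -⟩
  · rw [h0]; exact ⟨Set.finite_empty, by simp; positivity⟩
  have hu : (1 : ℝ) ≤ 2 ^ j := one_le_pow₀ (by norm_num)
  set u : ℝ := 2 ^ j with hudef
  have h1 : 1 ≤ 48 * lam / u ^ 3 := by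
    refine le_trans ?_ hFa
    exact_mod_cast Int.one_le_abs hF
  have hu3 : 1 ≤ u ^ 3 := one_le_pow₀ hu
  have huu : u ≤ u ^ 3 := le_self_pow₀ hu (by norm_num)
  have h2 : 1 ≤ 48 * lam / u := h1.trans (by gcongr)
  have hl : 1 ≤ 48 * lam := h1.trans (div_le_self (by positivity) hu3)
  have h3 : 1 ≤ 48 * lam * u := by nlinarith
  have h4 : 1 ≤ 48 * lam * u ^ 3 := by nlinarith
  have key : ∀ B : ℝ, 1 ≤ B → CardLE {n : ℤ | |(n : ℝ)| ≤ B} (3 * B) := fun B hB =>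
    (CardLE.int_abs_le B (by linarith)).mono le_rfl (by linarith)
  refine (CardLE.of_injOn (((key _ h1).prod (key _ h2)).prod ((key _ h3).prod (key _ h4)))
    (fun F : Cubic ℤ => ((F.a, F.b), (F.c, F.d))) ?_ ?_).mono le_rfl ?_
  · intro F _ G _ h
    simp only [Prod.mk.injEq] at h
    exact Cubic.ext h.1.1 h.1.2 h.2.1 h.2.2
  · rintro F ⟨-, ha, hb, hc, hd⟩
    exact ⟨⟨ha, hb⟩, hc, hd⟩
  · have hu0 : u ≠ 0 := by positivity
    apply le_of_eq
    field_simp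
    norm_num

/-- Here disc = b²(c² - 4bd), so |b| ≤ √X and, for given b and c, `d` takes O(X/|b|³ + 1) values.
Summing over |c| ≤ |b| gives O(X/b² + |b|), and summing over b gives O(X). -/
lemma cardLE_reducedCusp {X : ℝ} (hX : 0 ≤ X) :
    CardLE {F ∈ reducedCusp X | F.discr ≠ 0} (18 * X) := by
  set N := ⌊√X⌋₊ with hN
  have hNX : (N : ℝ) ^ 2 ≤ X := by
    have : (N : ℝ) ≤ √X := Nat.floor_le (Real.sqrt_nonneg X)
    calc (N : ℝ) ^ 2 ≤ √X ^ 2 := by gcongr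
      _ = X := Real.sq_sqrt hX
  have hline : ∀ b : ℤ, b ≠ 0 → ∀ c : ℤ, CardLE {F : Cubic ℤ | F.a = 0 ∧ F.b = b ∧ F.c = c ∧
      |(F.discr : ℝ)| ≤ X} (2 * (X / (2 * |(b : ℝ)| ^ 3)) + 1) := by
    intro b hb c
    have hb' : (b : ℝ) ≠ 0 := by exact_mod_cast hb
    refine CardLE.of_line (fun F k => ⟨0, b, c, F.d + k⟩) (by positivity) ?_
    rintro ⟨a₁, b₁, c₁, d₁⟩ ⟨h1, h2, h3, h4⟩ ⟨a₂, b₂, c₂, d₂⟩ ⟨g1, g2, g3, g4⟩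
    simp only at h1 h2 h3 g1 g2 g3
    subst h1 h2 h3 g1 g2 g3
    refine ⟨d₂ - d₁, by simp, ?_⟩
    simp only [Cubic.discr] at h4 g4
    push_cast at h4 g4 ⊢
    rw [le_div_iff₀ (by positivity)]
    have e : |(d₂ : ℝ) - d₁| * (2 * |(b₂ : ℝ)| ^ 3) * 2 = |4 * (b₂ : ℝ) ^ 3 * (d₂ - d₁)| := by
      rw [abs_mul, abs_mul, abs_pow]; norm_num; ring
    have e2 : |4 * (b₂ : ℝ) ^ 3 * (d₂ - d₁)| ≤ 2 * X := by
      refine abs_le.2 ⟨?_, ?_⟩ <;> nlinarith [abs_le.1 h4, abs_le.1 g4]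
    linarith
  have hb : ∀ n : ℕ, n ≠ 0 → ∀ b : ℤ, |(b : ℝ)| = n →
      CardLE {F ∈ reducedCusp X | F.b = b} (3 * X / n ^ 2 + 3 * n) := by
    intro n hn b hbn
    have hn1 : (1 : ℝ) ≤ n := by exact_mod_cast Nat.one_le_iff_ne_zero.2 hn
    have hb0 : b ≠ 0 := by
      rintro rfl; exact hn (by simpa using hbn.symm)
    have hl := CardLE.biUnion_set (CardLE.int_abs_le (n : ℝ) (by positivity)) _ (by positivity)
      fun c _ => hline b hb0 c
    refine hl.mono ?_ ?_
    · rintro F ⟨⟨ha, -, hc, hD⟩, hFb⟩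
      simp only [Set.mem_iUnion]
      refine ⟨F.c, ?_, ha, hFb, rfl, hD⟩
      have : |(F.c : ℝ)| ≤ |(F.b : ℝ)| := by exact_mod_cast hc
      change |(F.c : ℝ)| ≤ n
      rwa [hFb, hbn] at this
    · rw [hbn]
      calc (2 * (n : ℝ) + 1) * (2 * (X / (2 * n ^ 3)) + 1)
          ≤ (3 * n) * (2 * (X / (2 * n ^ 3)) + 1) := by gcongr; linarith
        _ = 3 * X / n ^ 2 + 3 * n := by field_simp
  have hn : ∀ n ∈ Finset.Ioo 0 (N + 1),
      CardLE {F ∈ reducedCusp X | F.b = n ∨ F.b = -n} (6 * X * ((n : ℝ) ^ 2)⁻¹ + 6 * N) := by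
    intro n hn
    rw [Finset.mem_Ioo] at hn
    have h1 := hb n (by omega) n (by simp)
    have h2 := hb n (by omega) (-n) (by simp)
    have hnN : (n : ℝ) ≤ N := by exact_mod_cast Nat.lt_succ_iff.1 hn.2
    refine (h1.union h2).mono ?_ ?_
    · rintro F ⟨hF, h | h⟩
      · exact Or.inl ⟨hF, h⟩
      · exact Or.inr ⟨hF, h⟩
    · rw [div_eq_mul_inv]; linarith
  refine (CardLE.biUnion_sum _ _ _ hn).mono ?_ ?_
  · rintro F ⟨hF, hD⟩
    simp only [Set.mem_iUnion]
    obtain ⟨ha, hb, hc, hX'⟩ := hF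
    refine ⟨F.b.natAbs, ?_, ⟨ha, hb, hc, hX'⟩, ?_⟩
    · have hdisc : F.discr = F.b ^ 2 * (F.c ^ 2 - 4 * F.b * F.d) := by
        simp only [Cubic.discr, ha]; ring
      have : |(F.b : ℝ)| ≤ √X := by
        apply Real.le_sqrt_of_sq_le
        refine le_trans ?_ hX'
        rw [hdisc] at hD ⊢
        have h1 := Int.one_le_abs (right_ne_zero_of_mul hD)
        have h1' : (1 : ℝ) ≤ |(F.c : ℝ) ^ 2 - 4 * F.b * F.d| := by exact_mod_cast h1
        push_cast
        rw [abs_mul, abs_pow]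
        nlinarith [sq_nonneg |(F.b : ℝ)|]
      have h2 : F.b.natAbs ≤ N := by
        apply Nat.le_floor
        rwa [Nat.cast_natAbs, Int.cast_abs]
      rw [Finset.mem_Ioo]
      omega
    · omega
  · rw [Finset.sum_add_distrib, ← Finset.mul_sum]
    have h1 := sum_Ioo_inv_sq_le (α := ℝ) 0 (N + 1)
    simp only [Nat.cast_zero, zero_add, div_one] at h1
    have h2 := mul_le_mul_of_nonneg_left h1 (show 0 ≤ 6 * X by positivity)
    simp only [Finset.sum_const, Nat.card_Ioo, Nat.add_sub_cancel, nsmul_eq_mul, Nat.sub_zero]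
    nlinarith

lemma abs_three_add_sign_mul_le {σ t₁ t₂ t₃ M : ℝ} (hσ : σ = 1 ∨ σ = -1) (h1 : |t₁| ≤ M)
    (h2 : |t₂| ≤ M) (h3 : |t₃| ≤ M) : |3 * t₁ + σ * (t₂ + 2 * t₃)| ≤ 6 * M := by
  rw [abs_le] at *
  rcases hσ with rfl | rfl <;> constructor <;> linarith

lemma abs_cube_add_sign_mul_le {σ x y m : ℝ} (hσ : σ = 1 ∨ σ = -1)
    (hm : m ^ 2 = x ^ 2 + y ^ 2) (hx : |x| ≤ m) : |x ^ 3 + σ * x * y ^ 2| ≤ m ^ 3 := by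
  have h1 : x ^ 3 + σ * x * y ^ 2 = x * (x ^ 2 + σ * y ^ 2) := by ring
  have hm0 := (abs_nonneg x).trans hx
  have h2 : |x ^ 2 + σ * y ^ 2| ≤ m ^ 2 := by
    rw [hm, abs_le]
    rcases hσ with rfl | rfl <;> constructor <;> nlinarith [sq_nonneg x, sq_nonneg y]
  rw [h1, abs_mul, pow_succ' m 2]
  gcongr

/-- Coefficient bounds for a form in normal form with respect to a reduced basis. -/
lemma IsNormal.mem_reducedBox {F : Cubic ℤ} {μ σ x₁ y₁ x₂ y₂ lam : ℝ} {L : ℕ}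
    (h : IsNormal F μ σ x₁ y₁ x₂ y₂) (ha : F.a ≠ 0) (hμ : |μ| ≤ lam) (hL : 48 * lam ≤ 2 ^ L)
    (h₁ : x₁ ^ 2 + y₁ ^ 2 ≤ x₂ ^ 2 + y₂ ^ 2)
    (h₂ : (x₁ ^ 2 + y₁ ^ 2) * (x₂ ^ 2 + y₂ ^ 2) ≤ 4 / 3) :
    ∃ j ∈ Finset.range (L + 1), F ∈ reducedBox lam j := by
  have hlam : 0 ≤ lam := (abs_nonneg μ).trans hμ
  set n₁ := √(x₁ ^ 2 + y₁ ^ 2) with hn₁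
  set n₂ := √(x₂ ^ 2 + y₂ ^ 2) with hn₂
  have s₁ : n₁ ^ 2 = x₁ ^ 2 + y₁ ^ 2 := Real.sq_sqrt (by positivity)
  have s₂ : n₂ ^ 2 = x₂ ^ 2 + y₂ ^ 2 := Real.sq_sqrt (by positivity)
  have hn₁0 : 0 < n₁ := by
    apply Real.sqrt_pos.2
    by_contra hcon
    have e1 : x₁ = 0 := by nlinarith [sq_nonneg x₁, sq_nonneg y₁]
    have e2 : y₁ = 0 := by nlinarith [sq_nonneg x₁, sq_nonneg y₁]
    have := h.det
    rw [e1, e2] at this; norm_num at this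
  have hn₂0 : 0 ≤ n₂ := Real.sqrt_nonneg _
  have h12 : n₁ ≤ n₂ := Real.sqrt_le_sqrt h₁
  have hp : n₁ * n₂ ≤ 2 := by
    apply abs_le_of_sq_le_sq' _ (by norm_num) |>.2
    rw [mul_pow, s₁, s₂]; linarith
  have hx₁ : |x₁| ≤ n₁ := Real.abs_le_sqrt (by nlinarith [sq_nonneg y₁])
  have hy₁ : |y₁| ≤ n₁ := Real.abs_le_sqrt (by nlinarith [sq_nonneg x₁])
  have hx₂ : |x₂| ≤ n₂ := Real.abs_le_sqrt (by nlinarith [sq_nonneg y₂])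
  have hy₂ : |y₂| ≤ n₂ := Real.abs_le_sqrt (by nlinarith [sq_nonneg x₂])
  have hn1le : n₁ / 2 ≤ 1 := by nlinarith
  -- 2^j is the cusp height: n₁ is of order 2^(-j), and n₁n₂ ≤ 2 makes n₂ at most of order 2^j.
  obtain ⟨j, hj1, hj2⟩ := exists_nat_pow_near_of_lt_one (x := n₁ / 2) (y := 1 / 2)
    (by positivity) hn1le (by norm_num) (by norm_num)
  set u : ℝ := 2 ^ j with hu
  have hu0 : 0 < u := by positivity
  have hn1u : n₁ ≤ 2 / u := by
    rw [one_div, inv_pow, ← hu] at hj2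
    rw [div_eq_mul_inv]; linarith
  have hn1u' : 1 ≤ n₁ * u := by
    rw [one_div, inv_pow, pow_succ, ← hu, inv_lt_iff_one_lt_mul₀ (by positivity)] at hj1
    linarith
  have hn2u : n₂ ≤ 2 * u := by nlinarith
  have mono : ∀ e B : ℝ, |e| ≤ B → |μ * e| ≤ lam * B := by
    intro e B he
    rw [abs_mul]
    exact mul_le_mul hμ he (abs_nonneg _) hlam
  have cub : ∀ a b c m₁ m₂ m₃ : ℝ, |a| ≤ m₁ → |b| ≤ m₂ → |c| ≤ m₃ →
      |a * b * c| ≤ m₁ * m₂ * m₃ := by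
    intro a b c m₁ m₂ m₃ h1 h2 h3
    have := (abs_nonneg a).trans h1
    have := (abs_nonneg b).trans h2
    rw [abs_mul, abs_mul]
    gcongr
  have six := fun t₁ t₂ t₃ M => abs_three_add_sign_mul_le (t₁ := t₁) (t₂ := t₂) (t₃ := t₃) (M := M) h.sign
  have two := fun x y m => abs_cube_add_sign_mul_le (x := x) (y := y) (m := m) h.sign
  have ba : |(F.a : ℝ)| ≤ 48 * lam / u ^ 3 := by
    rw [h.a_eq]
    refine (mono _ _ (two x₁ y₁ n₁ s₁ hx₁)).trans ?_
    calc lam * n₁ ^ 3 ≤ lam * (2 / u) ^ 3 := by gcongr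
      _ = 8 * lam / u ^ 3 := by field_simp; norm_num
      _ ≤ 48 * lam / u ^ 3 := by gcongr; norm_num
  have bb : |(F.b : ℝ)| ≤ 48 * lam / u := by
    rw [h.b_eq]
    have e : 3 * x₁ ^ 2 * x₂ + σ * (x₂ * y₁ ^ 2 + 2 * x₁ * y₁ * y₂)
        = 3 * (x₁ * x₁ * x₂) + σ * (y₁ * y₁ * x₂ + 2 * (x₁ * y₁ * y₂)) := by ring
    rw [e]
    refine (mono _ _ (six _ _ _ (n₁ * n₁ * n₂) (cub _ _ _ _ _ _ hx₁ hx₁ hx₂)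
      (cub _ _ _ _ _ _ hy₁ hy₁ hx₂) (cub _ _ _ _ _ _ hx₁ hy₁ hy₂))).trans ?_
    calc lam * (6 * (n₁ * n₁ * n₂)) ≤ lam * (6 * (2 / u * (2 / u) * (2 * u))) := by gcongr
      _ = 48 * lam / u := by field_simp; ring
  have bc : |(F.c : ℝ)| ≤ 48 * lam * u := by
    rw [h.c_eq]
    have e : 3 * x₁ * x₂ ^ 2 + σ * (x₁ * y₂ ^ 2 + 2 * x₂ * y₁ * y₂)
        = 3 * (x₁ * x₂ * x₂) + σ * (x₁ * y₂ * y₂ + 2 * (y₁ * x₂ * y₂)) := by ring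
    rw [e]
    refine (mono _ _ (six _ _ _ (n₁ * n₂ * n₂) (cub _ _ _ _ _ _ hx₁ hx₂ hx₂)
      (cub _ _ _ _ _ _ hx₁ hy₂ hy₂) (cub _ _ _ _ _ _ hy₁ hx₂ hy₂))).trans ?_
    calc lam * (6 * (n₁ * n₂ * n₂)) ≤ lam * (6 * (2 / u * (2 * u) * (2 * u))) := by gcongr
      _ = 48 * lam * u := by field_simp; ring
  have bd : |(F.d : ℝ)| ≤ 48 * lam * u ^ 3 := by
    rw [h.d_eq]
    refine (mono _ _ (two x₂ y₂ n₂ s₂ hx₂)).trans ?_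
    calc lam * n₂ ^ 3 ≤ lam * (2 * u) ^ 3 := by gcongr
      _ = 8 * lam * u ^ 3 := by ring
      _ ≤ 48 * lam * u ^ 3 := by gcongr; norm_num
  refine ⟨j, ?_, ha, ba, bb, bc, bd⟩
  -- Since |a| ≥ 1, the box cannot lie too far into the cusp: u³ ≤ 48 lam, which bounds j by L.
  have h1 : (1 : ℝ) ≤ 48 * lam / u ^ 3 := le_trans (by exact_mod_cast Int.one_le_abs ha) ba
  rw [le_div_iff₀ (by positivity), one_mul] at h1
  have h1u : 1 ≤ u := one_le_pow₀ (by norm_num)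
  have h3 : u ≤ u ^ 3 := le_self_pow₀ h1u (by norm_num)
  have h4 : (2 : ℝ) ^ j ≤ 2 ^ L := by rw [← hu]; linarith
  have := (pow_le_pow_iff_right₀ (by norm_num : (1 : ℝ) < 2)).1 h4
  exact Finset.mem_range.2 (by omega)

/-- Representatives for the `SL₂(ℤ)`-classes of forms of discriminant at most `4 lam ^ 4`. -/
def reducedForms (lam : ℝ) (L : ℕ) : Set (Cubic ℤ) :=
  (⋃ j ∈ Finset.range (L + 1), reducedBox lam j) ∪
    {F ∈ reducedCusp (4 * lam ^ 4) | F.discr ≠ 0}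

lemma cardLE_reducedForms {lam : ℝ} (hlam : 0 < lam) (L : ℕ) :
    CardLE (reducedForms lam L) (144 ^ 4 * lam ^ 4 * (L + 2)) := by
  refine ((CardLE.biUnion (Finset.range (L + 1)) _ _ fun j _ => cardLE_reducedBox hlam j).union
    (cardLE_reducedCusp (show 0 ≤ 4 * lam ^ 4 by positivity))).mono le_rfl ?_
  rw [Finset.card_range]
  push_cast
  have : 0 ≤ lam ^ 4 := by positivity
  nlinarith

/-- Reduction may produce leading coefficient 0 although `F` has none; a shear then brings |c| below
|b|. The normal form is carried along the substitutions, because `exists_isNormal` needs a nonzero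
leading coefficient. -/
lemma exists_reducedForm {F : Cubic ℤ} {lam : ℝ} {L : ℕ} (ha : F.a ≠ 0) (hD : F.discr ≠ 0)
    (hlam : 0 ≤ lam) (hDle : |(F.discr : ℝ)| ≤ 4 * lam ^ 4) (hL : 48 * lam ≤ 2 ^ L) :
    ∃ G ∈ reducedForms lam L, (∃ μ σ x₁ y₁ x₂ y₂ : ℝ, IsNormal G μ σ x₁ y₁ x₂ y₂ ∧
        4 * μ ^ 4 = |(F.discr : ℝ)|) ∧
      ∃ p q r s : ℤ, p * s - q * r = 1 ∧ F = G.act p q r s := by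
  obtain ⟨μ, σ, x₁, y₁, x₂, y₂, hN⟩ := exists_isNormal ha hD
  have hμ4 := hN.abs_discr
  have hμ : |μ| ≤ lam := by
    rw [hμ4] at hDle
    refine le_of_pow_le_pow_left₀ (n := 4) (by norm_num) hlam ?_
    rw [← abs_pow, abs_of_nonneg (by positivity)]
    linarith
  obtain ⟨p, q, r, s, hdet, hle, hprod⟩ := exists_reduced_basis hN.det
  have hG := hN.act hdet
  set G := F.act p q r s with hGdef
  have hFG : F = G.act s (-q) (-r) p := by
    have := act_act_inv F (p := s) (q := -q) (r := -r) (s := p) (by linear_combination hdet)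
    simpa using this.symm
  by_cases hGa : G.a = 0
  · have hGD : |(G.discr : ℝ)| = |(F.discr : ℝ)| := by rw [hG.abs_discr, hμ4]
    have hGD0 : G.discr ≠ 0 := by
      intro h0
      rw [h0] at hGD
      simp only [Int.cast_zero, abs_zero] at hGD
      exact hD (by exact_mod_cast (abs_eq_zero.1 hGD.symm))
    have hGb : G.b ≠ 0 := by
      intro hb; apply hGD0; simp [Cubic.discr, hGa, hb]
    set k : ℤ := -round ((G.c : ℝ) / (2 * G.b)) with hk
    have hGk := hG.act (p := 1) (q := 0) (r := k) (s := 1) (by ring)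
    set G' := G.act 1 0 k 1 with hG'
    have ea : G'.a = 0 := by simp [hG', act, hGa]
    have eb : G'.b = G.b := by simp [hG', act, hGa]
    have ec : G'.c = G.c + 2 * G.b * k := by simp [hG', act, hGa]; ring
    have hG'D : |(G'.discr : ℝ)| = |(F.discr : ℝ)| := by rw [hGk.abs_discr, hμ4]
    have hG'D0 : G'.discr ≠ 0 := by
      intro h0
      rw [h0] at hG'D
      simp only [Int.cast_zero, abs_zero] at hG'D
      exact hD (by exact_mod_cast (abs_eq_zero.1 hG'D.symm))
    refine ⟨G', Or.inr ⟨⟨ea, eb ▸ hGb, ?_, hG'D ▸ hDle⟩, hG'D0⟩,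
      ⟨_, _, _, _, _, _, hGk, hμ4.symm⟩, s + k * q, -q, -r - k * p, p,
        by linear_combination hdet, ?_⟩
    · have h1 := abs_sub_round ((G.c : ℝ) / (2 * G.b))
      have hb' : (G.b : ℝ) ≠ 0 := by exact_mod_cast hGb
      have e : (G'.c : ℝ) = (2 * G.b) * ((G.c : ℝ) / (2 * G.b)
          - round ((G.c : ℝ) / (2 * G.b))) := by
        rw [ec, hk]; push_cast; field_simp; ring
      have : |(G'.c : ℝ)| ≤ |(G'.b : ℝ)| := by
        rw [e, eb, abs_mul, abs_mul]
        have := mul_le_mul_of_nonneg_left h1 (show 0 ≤ |(2 : ℝ)| * |(G.b : ℝ)| by positivity)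
        norm_num at this ⊢
        linarith
      exact_mod_cast this
    · rw [hG', act_act]
      conv_lhs => rw [hFG]
      congr 1 <;> ring
  · refine ⟨G, Or.inl ?_, ⟨_, _, _, _, _, _, hG, hμ4.symm⟩, s, -q, -r, p,
      by linear_combination hdet, hFG⟩
    simp only [Set.mem_iUnion]
    obtain ⟨j, hj, hj'⟩ := hG.mem_reducedBox hGa hμ hL hle hprod
    exact ⟨j, hj, hj'⟩

end Cubic

/-! ### Summation over discriminants. -/

namespace Cubic

lemma HeightLE.abs_discr_le {F : Cubic ℤ} {H : ℝ} (h : F.HeightLE H) :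
    |(F.discr : ℝ)| ≤ 54 * H ^ 4 := by
  obtain ⟨ha, hb, hc, hd⟩ := h
  have h4 : ∀ w x y z : ℝ, |w| ≤ H → |x| ≤ H → |y| ≤ H → |z| ≤ H → |w * x * y * z| ≤ H ^ 4 := by
    intro w x y z hw hx hy hz
    have hH : 0 ≤ H := (abs_nonneg w).trans hw
    rw [abs_mul, abs_mul, abs_mul]
    calc |w| * |x| * |y| * |z| ≤ H * H * H * H := by gcongr
      _ = H ^ 4 := by ring
  have e : (F.discr : ℝ) = (F.b * F.b * F.c * F.c : ℝ) - 4 * (F.a * F.c * F.c * F.c)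
      - 4 * (F.b * F.b * F.b * F.d) - 27 * (F.a * F.a * F.d * F.d)
      + 18 * (F.a * F.b * F.c * F.d) := by
    simp only [Cubic.discr]; push_cast; ring
  have h1 := abs_le.1 (h4 _ _ _ _ hb hb hc hc)
  have h2 := abs_le.1 (h4 _ _ _ _ ha hc hc hc)
  have h3 := abs_le.1 (h4 _ _ _ _ hb hb hb hd)
  have h4' := abs_le.1 (h4 _ _ _ _ ha ha hd hd)
  have h5 := abs_le.1 (h4 _ _ _ _ ha hb hc hd)
  rw [e, abs_le]
  constructor <;> linarith

/-- Forms of bounded height whose discriminant lies in a dyadic range. -/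
lemma cardLE_dyadic_discr {H D X : ℝ} {L : ℕ} (hH : 1 ≤ H) (hD : 0 < D) (hX : 1 ≤ X)
    (hL : 144 * H ≤ 2 ^ L) :
    CardLE {F : Cubic ℤ | F.a ≠ 0 ∧ F.HeightLE H ∧ X ≤ |(F.discr : ℝ)| ∧
      |(F.discr : ℝ)| ≤ 2 * X ∧ |(F.discr : ℝ)| ≤ D}
      (144 ^ 4 * 4920 * (L + 2) ^ 2 * (H ^ (2 / 3 : ℝ) * D ^ (5 / 6 : ℝ))) := by
  set S := {F : Cubic ℤ | F.a ≠ 0 ∧ F.HeightLE H ∧ X ≤ |(F.discr : ℝ)| ∧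
      |(F.discr : ℝ)| ≤ 2 * X ∧ |(F.discr : ℝ)| ≤ D} with hS
  have hH0 : 0 < H := by linarith
  have hX0 : 0 < X := by linarith
  rcases S.eq_empty_or_nonempty with h0 | ⟨F₀, -, hF₀, hF₀X, -, hF₀D⟩
  · rw [h0]; exact ⟨Set.finite_empty, by simp; positivity⟩
  have hXD : X ≤ D := hF₀X.trans hF₀D
  have hXH : X ≤ 54 * H ^ 4 := hF₀X.trans hF₀.abs_discr_le
  -- Chosen so that |μ| t³ ≥ H whenever 4μ⁴ ≥ X.
  obtain ⟨t, ht0, ht⟩ : ∃ t : ℝ, 0 < t ∧ t ^ 12 * X = 4 * H ^ 4 := by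
    have hq : 0 < 4 * H ^ 4 / X := by positivity
    refine ⟨(4 * H ^ 4 / X) ^ (1 / 12 : ℝ), Real.rpow_pos_of_pos hq _, ?_⟩
    rw [← Real.rpow_natCast, ← Real.rpow_mul hq.le]
    norm_num
    field_simp
  obtain ⟨lam, hlam0, hlam⟩ : ∃ lam : ℝ, 0 < lam ∧ 2 * lam ^ 4 = X := by
    have hq : 0 < X / 2 := by positivity
    refine ⟨(X / 2) ^ (1 / 4 : ℝ), Real.rpow_pos_of_pos hq _, ?_⟩
    rw [← Real.rpow_natCast, ← Real.rpow_mul hq.le]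
    norm_num
    field_simp
  have hlamH : lam ≤ 3 * H := by
    refine le_of_pow_le_pow_left₀ (n := 4) (by norm_num) (by positivity) ?_
    have : 0 ≤ H ^ 4 := by positivity
    rw [mul_pow]; norm_num; linarith
  -- 16 t¹² X = 64 H⁴ exceeds 54 H⁴ ≥ X.
  have ht3 : 1 ≤ 2 * t ^ 3 := by
    refine le_of_pow_le_pow_left₀ (n := 4) (by norm_num) (by positivity) ?_
    have e : (2 * t ^ 3) ^ 4 = 16 * t ^ 12 := by ring
    rw [e, one_pow]
    have : X * 1 ≤ X * (16 * t ^ 12) := by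
      have : 0 ≤ H ^ 4 := by positivity
      linarith
    exact le_of_mul_le_mul_left this hX0
  have ht12 : t ^ 12 ≤ 4 * H ^ 4 := by
    rw [← ht]; exact le_mul_of_one_le_right (by positivity) hX
  have htL : 4 * t ^ 2 ≤ 2 ^ L := by
    refine le_trans ?_ (show 8 * H ≤ 2 ^ L by linarith)
    refine le_of_pow_le_pow_left₀ (n := 6) (by norm_num) (by positivity) ?_
    have e : (4 * t ^ 2) ^ 6 = 4096 * t ^ 12 := by ring
    have e2 : (8 * H) ^ 6 = 262144 * H ^ 6 := by ring
    have : H ^ 4 ≤ H ^ 6 := pow_le_pow_right₀ hH (by norm_num)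
    rw [e, e2]; linarith
  have ht2 : 1 ≤ 2 * t ^ 2 := by
    by_contra hcon
    push Not at hcon
    have ht1 : t ≤ 1 := by nlinarith
    nlinarith
  have horbit : ∀ G ∈ reducedForms lam L, CardLE {f : Cubic ℤ | f ∈ S ∧
      (∃ μ σ x₁ y₁ x₂ y₂ : ℝ, IsNormal G μ σ x₁ y₁ x₂ y₂ ∧ 4 * μ ^ 4 = |(f.discr : ℝ)|) ∧
      ∃ p q r s : ℤ, p * s - q * r = 1 ∧ f = G.act p q r s}
      (30 * ((L + 1) * (2 + 160 * t ^ 2))) := by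
    intro G _
    set T := {f : Cubic ℤ | f ∈ S ∧
      (∃ μ σ x₁ y₁ x₂ y₂ : ℝ, IsNormal G μ σ x₁ y₁ x₂ y₂ ∧ 4 * μ ^ 4 = |(f.discr : ℝ)|) ∧
      ∃ p q r s : ℤ, p * s - q * r = 1 ∧ f = G.act p q r s} with hT
    rcases T.eq_empty_or_nonempty with h0 | ⟨f, hf, ⟨μ, σ, x₁, y₁, x₂, y₂, hN, hμ⟩, -⟩
    · rw [h0]; exact ⟨Set.finite_empty, by simp; positivity⟩
    have hμX : X ≤ 4 * μ ^ 4 := hμ ▸ hf.2.2.1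
    have hμ0 : μ ≠ 0 := by
      rintro rfl; norm_num at hμX; linarith
    have hHμ : H ≤ |μ| * t ^ 3 := by
      refine le_of_pow_le_pow_left₀ (n := 4) (by norm_num) (by positivity) ?_
      have e : (|μ| * t ^ 3) ^ 4 = μ ^ 4 * t ^ 12 := by
        rw [mul_pow, ← abs_pow, abs_of_nonneg (by positivity : 0 ≤ μ ^ 4)]; ring
      have : t ^ 12 * X ≤ t ^ 12 * (4 * μ ^ 4) := by gcongr
      rw [e]; linarith
    refine (cardLE_orbit hN hμ0 ht0 hHμ ht3 htL).mono ?_ le_rfl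
    rintro g ⟨hg, -, hg'⟩
    exact ⟨hg.2.1, hg'⟩
  refine (CardLE.biUnion_set (cardLE_reducedForms hlam0 L) _ (by positivity) horbit).mono ?_ ?_
  · intro f hf
    obtain ⟨ha, hfH, hfX, hf2X, hfD⟩ := hf
    have hf0 : f.discr ≠ 0 := by
      intro h0; rw [h0] at hfX; norm_num at hfX; linarith
    obtain ⟨G, hG, hGN, hGf⟩ := exists_reducedForm (lam := lam) (L := L) ha hf0 hlam0.le
      (by linarith) (by linarith)
    simp only [Set.mem_iUnion]
    exact ⟨G, hG, ⟨ha, hfH, hfX, hf2X, hfD⟩, hGN, hGf⟩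
  -- Sixth powers: (X t²)⁶ = 4 X⁵ H⁴, with X ≤ D.
  · have hXt : X * t ^ 2 ≤ 2 * (H ^ (2 / 3 : ℝ) * D ^ (5 / 6 : ℝ)) := by
      refine le_of_pow_le_pow_left₀ (n := 6) (by norm_num) (by positivity) ?_
      have e : (X * t ^ 2) ^ 6 = X ^ 5 * (4 * H ^ 4) := by rw [← ht]; ring
      have e2 : (2 * (H ^ (2 / 3 : ℝ) * D ^ (5 / 6 : ℝ))) ^ 6 = 64 * (H ^ 4 * D ^ 5) := by
        rw [mul_pow, mul_pow, ← Real.rpow_natCast (H ^ (2 / 3 : ℝ)), ← Real.rpow_mul hH0.le,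
          ← Real.rpow_natCast (D ^ (5 / 6 : ℝ)), ← Real.rpow_mul hD.le]
        norm_num
      have h5 : X ^ 5 ≤ D ^ 5 := by gcongr
      rw [e, e2]
      have : X ^ 5 * (4 * H ^ 4) ≤ D ^ 5 * (4 * H ^ 4) := by gcongr
      have : 0 ≤ H ^ 4 * D ^ 5 := by positivity
      linarith
    have hl : lam ^ 4 = X / 2 := by linarith
    rw [hl]
    calc 144 ^ 4 * (X / 2) * ((L : ℝ) + 2) * (30 * ((L + 1) * (2 + 160 * t ^ 2)))
        ≤ 144 ^ 4 * (X / 2) * ((L : ℝ) + 2) * (30 * ((L + 2) * (164 * t ^ 2))) := by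
          gcongr <;> linarith
      _ = 144 ^ 4 * 2460 * ((L : ℝ) + 2) ^ 2 * (X * t ^ 2) := by ring
      _ ≤ 144 ^ 4 * 2460 * ((L : ℝ) + 2) ^ 2 * (2 * (H ^ (2 / 3 : ℝ) * D ^ (5 / 6 : ℝ))) := by
          gcongr
      _ = _ := by ring

lemma cardLE_bounded_discr {H D : ℝ} {L : ℕ} (hH : 1 ≤ H) (hD : 0 < D)
    (hL : 144 * H ≤ 2 ^ L) :
    CardLE {F : Cubic ℤ | F.a ≠ 0 ∧ F.HeightLE H ∧ F.discr ≠ 0 ∧ |(F.discr : ℝ)| ≤ D}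
      (144 ^ 4 * 19680 * (L + 2) ^ 3 * (H ^ (2 / 3 : ℝ) * D ^ (5 / 6 : ℝ))) := by
  refine (CardLE.biUnion (Finset.range (4 * L + 1)) _ _ fun i _ =>
    cardLE_dyadic_discr (X := 2 ^ i) hH hD (one_le_pow₀ (by norm_num)) hL).mono ?_ ?_
  · rintro F ⟨ha, hFH, hF0, hFD⟩
    have h1 : (1 : ℝ) ≤ |(F.discr : ℝ)| := by exact_mod_cast Int.one_le_abs hF0
    obtain ⟨i, hi1, hi2⟩ := exists_nat_pow_near h1 (by norm_num : (1 : ℝ) < 2)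
    simp only [Set.mem_iUnion]
    refine ⟨i, ?_, ha, hFH, hi1, ?_, hFD⟩
    -- The height bounds the discriminant by 54 H⁴ ≤ (144 H)⁴ ≤ 2^(4L), so 4L + 1 dyadic ranges
    -- suffice.
    · have h2 : (2 : ℝ) ^ i ≤ 2 ^ (L * 4) := by
        rw [pow_mul]
        have h3 : (144 * H) ^ 4 ≤ ((2 : ℝ) ^ L) ^ 4 := by gcongr
        have h4 : (0 : ℝ) ≤ H ^ 4 := by positivity
        have h5 := hFH.abs_discr_le
        rw [mul_pow] at h3
        norm_num at h3 ⊢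
        linarith
      have := (pow_le_pow_iff_right₀ (by norm_num : (1 : ℝ) < 2)).1 h2
      exact Finset.mem_range.2 (by omega)
    · rw [pow_succ] at hi2; linarith
  · rw [Finset.card_range]
    push_cast
    calc (4 * (L : ℝ) + 1) * (144 ^ 4 * 4920 * (L + 2) ^ 2 * (H ^ (2 / 3 : ℝ) * D ^ (5 / 6 : ℝ)))
        ≤ (4 * ((L : ℝ) + 2)) *
          (144 ^ 4 * 4920 * (L + 2) ^ 2 * (H ^ (2 / 3 : ℝ) * D ^ (5 / 6 : ℝ))) := by
          gcongr; linarith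
      _ = _ := by ring

end Cubic

/-! ### Return to polynomials and absorption of logarithms. -/

lemma cardLE_boundedCubics {H D : ℝ} {L : ℕ} (hH : 1 ≤ H) (hD : 0 < D)
    (hL : 144 * H ≤ 2 ^ L) :
    CardLE (boundedCubics H D)
      (144 ^ 4 * 19680 * (L + 2) ^ 3 * (H ^ (2 / 3 : ℝ) * D ^ (5 / 6 : ℝ))) := by
  refine (Cubic.cardLE_bounded_discr hH hD hL).of_injOn
    (fun P => ⟨P.coeff 3, P.coeff 2, P.coeff 1, P.coeff 0⟩) ?_ ?_
  · rintro P ⟨hP, -⟩ Q ⟨hQ, -⟩ h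
    simp only [Cubic.mk.injEq] at h
    ext n
    rcases lt_or_ge 3 n with hn | hn
    · rw [Polynomial.coeff_eq_zero_of_natDegree_lt (by omega),
        Polynomial.coeff_eq_zero_of_natDegree_lt (by omega)]
    · interval_cases n
      exacts [h.2.2.2, h.2.2.1, h.2.1, h.1]
  · rintro P ⟨hP, hPH, hP0, hPD⟩
    have hcoeff : ∀ i, |(P.coeff i : ℝ)| ≤ H := fun i => by
      have := P.le_supNorm i
      rw [Int.norm_eq_abs] at this
      exact this.trans hPH
    have hne : P ≠ 0 := by rintro rfl; simp at hP
    have hdisc : Cubic.discr ⟨P.coeff 3, P.coeff 2, P.coeff 1, P.coeff 0⟩ = P.discr := by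
      rw [Polynomial.discr_of_degree_eq_three
        ((Polynomial.degree_eq_iff_natDegree_eq hne).2 (by exact_mod_cast hP))]
      simp only [Cubic.discr]
    refine ⟨?_, ⟨hcoeff 3, hcoeff 2, hcoeff 1, hcoeff 0⟩, ?_, ?_⟩
    · have := Polynomial.leadingCoeff_ne_zero.2 hne
      rwa [Polynomial.leadingCoeff, hP] at this
    · rw [hdisc]; exact abs_pos.1 hP0
    · rw [hdisc]; exact_mod_cast hPD

lemma boundedCubics_eq_empty {H D : ℝ} (hH : H < 1) : boundedCubics H D = ∅ := by
  refine Set.eq_empty_of_forall_notMem ?_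
  rintro P ⟨hP, hPH, -⟩
  have hne : P ≠ 0 := by rintro rfl; simp at hP
  have h1 := (P.le_supNorm P.natDegree).trans hPH
  rw [Int.norm_eq_abs] at h1
  have h2 : (1 : ℝ) ≤ |(P.coeff P.natDegree : ℝ)| := by
    exact_mod_cast Int.one_le_abs (Polynomial.leadingCoeff_ne_zero.2 hne)
  linarith

lemma exists_nat_two_pow_ge_and_le_rpow {δ : ℝ} (hδ : 0 < δ) :
    ∃ M : ℝ, 0 < M ∧ ∀ H : ℝ, 1 ≤ H → ∃ L : ℕ, 144 * H ≤ 2 ^ L ∧ (L : ℝ) + 2 ≤ M * H ^ δ := by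
  refine ⟨2 * 144 ^ δ / δ + 3, by positivity, fun H hH => ⟨⌈Real.logb 2 (144 * H)⌉₊, ?_, ?_⟩⟩
  · have h1 := Nat.le_ceil (Real.logb 2 (144 * H))
    rw [Real.logb_le_iff_le_rpow (by norm_num) (by positivity), Real.rpow_natCast] at h1
    exact h1
  · have h0 : 0 ≤ Real.log (144 * H) := Real.log_nonneg (by linarith)
    have hl2 := Real.log_two_gt_d9
    have h1 : Real.logb 2 (144 * H) ≤ 2 * Real.log (144 * H) := by
      rw [Real.logb, div_le_iff₀ (by linarith)]
      nlinarith
    have h2 := Real.log_le_rpow_div (show 0 ≤ 144 * H by positivity) hδ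
    rw [Real.mul_rpow (by norm_num) (by positivity)] at h2
    have h3 : 1 ≤ H ^ δ := Real.one_le_rpow hH hδ.le
    have h4 := Nat.ceil_lt_add_one (show 0 ≤ Real.logb 2 (144 * H) from
      Real.logb_nonneg (by norm_num) (by linarith))
    have e : (2 * 144 ^ δ / δ + 3) * H ^ δ = 2 * (144 ^ δ * H ^ δ / δ) + 3 * H ^ δ := by ring
    rw [e]
    linarith

theorem theorem4 (ε : ℝ) (hε : 0 < ε) :
    ∃ c : ℝ, 0 < c ∧ ∀ H D : ℝ, 0 < H → 0 < D →
      (boundedCubics H D).Finite ∧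
        ((boundedCubics H D).ncard : ℝ) ≤ c * H ^ (2 / 3 + ε) * D ^ (5 / 6 : ℝ) := by
  -- Three factors L + 2 occur (dyadic ranges, classes, orbit scales), so each may cost H^(ε/3).
  obtain ⟨M, hM, hML⟩ := exists_nat_two_pow_ge_and_le_rpow (δ := ε / 3) (by positivity)
  refine ⟨144 ^ 4 * 19680 * M ^ 3, by positivity, fun H D hH hD => ?_⟩
  rcases lt_or_ge H 1 with hH1 | hH1
  · rw [boundedCubics_eq_empty hH1]
    exact ⟨Set.finite_empty, by simp; positivity⟩
  obtain ⟨L, hL, hLM⟩ := hML H hH1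
  refine (cardLE_boundedCubics hH1 hD hL).mono le_rfl ?_
  have hpow : (H ^ (ε / 3)) ^ 3 = H ^ ε := by
    rw [← Real.rpow_natCast, ← Real.rpow_mul hH.le]; norm_num
  calc 144 ^ 4 * 19680 * ((L : ℝ) + 2) ^ 3 * (H ^ (2 / 3 : ℝ) * D ^ (5 / 6 : ℝ))
      ≤ 144 ^ 4 * 19680 * (M * H ^ (ε / 3)) ^ 3 * (H ^ (2 / 3 : ℝ) * D ^ (5 / 6 : ℝ)) := by gcongr
    _ = 144 ^ 4 * 19680 * M ^ 3 * H ^ (2 / 3 + ε) * D ^ (5 / 6 : ℝ) := by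
      rw [mul_pow, hpow, Real.rpow_add hH]; ring
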